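/- \textbf{Setting.} Fix $L, L_C, L_F, N, D, \lambda, \Lambda\in\mathbb N$ with $L_F, D,\lambda\ge 1$, $L-L_F+1\ge L_C+L_F$ and $\lambda\le\Lambda\le N\lambda$, and reals $\sigma, C>0$, $\eta\in\mathbb R$, $\theta_0\in\mathbb R^D$. A dataset $x=\{x_1,\dots,x_N\}$ consists of $N$ distinct sequences $x_n\in\mathbb R^L$, in a fixed order. Write $x\simeq x'$ if there is exactly one $n$ with $x_n\ne x'_n$, and $x_n,x'_n$ differ in exactly one time index ($1$-event-level neighbors). A model consists of a function $f_\theta$ with parameters $\theta\in\mathbb R^D$ that maps $\mathbb R^{L_C}$ to some prediction space, and a real-valued loss $\mathcal L$ comparing predictions with elements of $\mathbb R^{L_F}$, such that $\theta\mapsto\mathcal L(f_\theta(c),y)$ is differentiable for all $c\in\mathbb R^{L_C}$, $y\in\mathbb R^{L_F}$. \textbf{Epoch $M$} (deterministic top-level iteration, bottom-level Poisson sampling). Start with $\theta=\theta_0$. For $b=1,\dots,\lfloor N\lambda/\Lambda\rfloor$: the top-level batch consists of the $x_n$ with $1+(b-1)N'\le n\le bN'$, where $N'=\lfloor\Lambda/\lambda\rfloor$.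 For each such $n$ let $\bar x_n\in\mathbb R^{L_C+L}$ be $x_n$ with $L_C$ zeros prepended, and for each $t=1,\dots,L-L_F+1$ include the subsequence $\bar x_n[t:t+L_C+L_F-1]$ in the multiset $y$ independently with probability $r=\min\{1,\lambda/(L-L_F+1)\}$. Split each $y_i\in y$ into its first $L_C$ entries $y_{C,i}$ and last $L_F$ entries $y_{F,i}$, let $g_i=\nabla_\theta\mathcal L(f_\theta(y_{C,i}),y_{F,i})$ and $$\tilde g^{(b)}=\frac1\Lambda\Big(\sum_i \frac{g_i}{\max\{1,\|g_i\|_2/C\}}+Z_b\Big),\qquad Z_b\sim\mathcal N(0,\sigma^2C^2 I),$$ with fresh independent sampling and noise in each step, and update $\theta\leftarrow\theta-\eta\,\tilde g^{(b)}$. The mechanism releases the noisy gradients of all steps; $M_x$ denotes the joint law of $(\tilde g^{(b)})_b$ on input $x$. For probability distributions $P,Q$ and $\alpha\ge0$ let $H_\alpha(P\|Q)=\int\max\{\frac{dP}{dQ}-\alpha,0\}\,dQ$. The pair $(P,Q)$ is a \emph{dominating pair} of $M$ if $\sup_{x\simeq x'}H_\alpha(M_x\|M_{x'})\le H_\alpha(P\|Q)$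 for all $\alpha\ge 0$, and a \emph{tight dominating pair} if equality holds for all $\alpha\ge0$. \textbf{Theorem.} Let $$P(\lambda)=\sum_{i=1}^{L_C+L_F+1}p_i\,\mathcal N(-\mu_i,\sigma^2),\qquad Q(\lambda)=\sum_{i=1}^{L_C+L_F+1}p_i\,\mathcal N(\mu_i,\sigma^2),$$ where $\mu_i=i-1$ and $p_i=\binom{L_C+L_F}{i-1}r^{i-1}(1-r)^{L_C+L_F-i+1}$. Then $(P(\lambda),Q(\lambda))$ is a dominating pair of the epoch $M$ for every model, and it is tight: there is a model for which $(P(\lambda),Q(\lambda))$ is a tight dominating pair of $M$. -/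

import Mathlib

open MeasureTheory ProbabilityTheory
open scoped NNReal ENNReal

universe u

noncomputable section

/-! ### Hockey-stick divergence, dominating pairs, mixtures of Gaussians -/

/-- The hockey-stick divergence `H_α(P ‖ Q) = ∫ max {dP/dQ - α, 0} dQ`
(the subtraction of extended nonnegative reals is truncated at `0`). -/
def hockeyStick {Ω : Type*} [MeasurableSpace Ω] (α : ℝ≥0) (P Q : Measure Ω) : ℝ≥0∞ :=
  ∫⁻ o, (P.rnDeriv Q o - (α : ℝ≥0∞)) ∂Q

/-- `sup_{x ≃ x'} H_α(M_x ‖ M_{x'})`, where `M x` is the output distribution on input `x`. -/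
def privacyProfile {X Ω : Type*} [MeasurableSpace Ω] (nbr : X → X → Prop) (M : X → Measure Ω)
    (α : ℝ≥0) : ℝ≥0∞ :=
  ⨆ (x : X) (x' : X) (_ : nbr x x'), hockeyStick α (M x) (M x')

/-- `(P, Q)` is a dominating pair of distributions for the mechanism `M`. -/
def IsDominatingPair {X Ω Ω' : Type*} [MeasurableSpace Ω] [MeasurableSpace Ω']
    (nbr : X → X → Prop) (M : X → Measure Ω) (P Q : Measure Ω') : Prop :=
  IsProbabilityMeasure P ∧ IsProbabilityMeasure Q ∧
    ∀ α : ℝ≥0, privacyProfile nbr M α ≤ hockeyStick α P Q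

/-- `(P, Q)` is a tight dominating pair of distributions for the mechanism `M`. -/
def IsTightDominatingPair {X Ω Ω' : Type*} [MeasurableSpace Ω] [MeasurableSpace Ω']
    (nbr : X → X → Prop) (M : X → Measure Ω) (P Q : Measure Ω') : Prop :=
  IsProbabilityMeasure P ∧ IsProbabilityMeasure Q ∧
    ∀ α : ℝ≥0, privacyProfile nbr M α = hockeyStick α P Q

/-- The mixture of the univariate Gaussians with means `μ k`, standard deviation `σ` and
weights `p k`. -/
def MoG {K : ℕ} (μ p : Fin K → ℝ) (σ : ℝ≥0) : Measure ℝ :=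
  ∑ k, ENNReal.ofReal (p k) • gaussianReal (μ k) (σ ^ 2)

/-! ### Datasets of time series -/

/-- A dataset `{x_1, …, x_N}` of `N` distinct univariate time series of length `L`, in the order
in which they are iterated over (the indices are `0, …, N - 1`). -/
abbrev Dataset (N L : ℕ) : Type := Fin N ↪ (Fin L → ℝ)

/-- `w`-event-level neighbors: the datasets differ in exactly one pair of sequences, and these two
differ only in a range of indices of length `w`. -/
def EventNeighbor {N L : ℕ} (w : ℕ) (x x' : Dataset N L) : Prop :=
  ∃ n : Fin N, (∀ m, m ≠ n → x m = x' m) ∧ x n ≠ x' n ∧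
    ∃ t : Fin L, ∀ s : Fin L, x n s ≠ x' n s → (t : ℕ) ≤ s ∧ (s : ℕ) < t + w

/-! ### Subsampling -/

/-- The number `L - L_F + 1` of start indices of subsequences. -/
def numStarts (L LF : ℕ) : ℕ := L + 1 - LF

/-- The subsequence of length `L_C + L_F` that starts at the (0-based) position `t` of the sequence
`a` after `L_C` zeros have been prepended to it. -/
def subsequence (LC LF : ℕ) {L : ℕ} (a : Fin L → ℝ) (t : Fin (numStarts L LF)) :
    Fin (LC + LF) → ℝ :=
  fun i => Fin.append (fun _ : Fin LC => (0 : ℝ)) a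
    ⟨t + i, by have ht := t.isLt; have hi := i.isLt; unfold numStarts at ht; omega⟩

/-- The sampling rate `r = min {1, λ / (L - L_F + 1)}`. -/
def samplingRate (L LF lam : ℕ) : unitInterval :=
  ⟨min 1 ((lam : ℝ) / (numStarts L LF : ℝ)), le_min zero_le_one (by positivity), min_le_left _ _⟩

/-- Deterministic top-level iteration: the indices of the sequences that form the `b`-th batch
(`b = 0, 1, …`), i.e. the `b`-th block of `⌊Λ / λ⌋` consecutive indices. -/
def topLevelBatch (N lam Lam b : ℕ) : Finset (Fin N) :=
  Finset.univ.filter fun n => b * (Lam / lam) ≤ (n : ℕ) ∧ (n : ℕ) < (b + 1) * (Lam / lam)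

/-- The outcome of bottom-level sampling for one batch: for each sequence of the batch and each
start index, whether the corresponding subsequence is included. -/
abbrev SampleMask (N L LF lam Lam b : ℕ) : Type :=
  topLevelBatch N lam Lam b → Fin (numStarts L LF) → Bool

/-- Bottom-level Poisson sampling: each subsequence of each sequence of the batch is included
independently with probability `r`. -/
def poissonSampling (N L LF lam Lam b : ℕ) : Measure (SampleMask N L LF lam Lam b) :=
  Measure.pi fun _ => Measure.pi fun _ => bernoulliMeasure true false (samplingRate L LF lam)

/-! ### Noisy training -/

/-- A parametric forecasting model `f_θ` with parameters `θ ∈ ℝ^D` that maps a context window of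
length `L_C` to a prediction, with a loss that compares predictions to ground-truth forecast
windows of length `L_F`; the loss of `f_θ` is differentiable in `θ`. -/
structure ForecastModel (D LC LF : ℕ) where
  Pred : Type u
  predict : EuclideanSpace ℝ (Fin D) → (Fin LC → ℝ) → Pred
  loss : Pred → (Fin LF → ℝ) → ℝ
  differentiable_loss : ∀ (c : Fin LC → ℝ) (y : Fin LF → ℝ),
    Differentiable ℝ fun θ => loss (predict θ c) y

/-- The gradient `∇_θ ℒ(f_θ(y_C), y_F)` for the subsequence `y` with context window `y_C` (the first
`L_C` elements) and forecast window `y_F` (the last `L_F` elements). -/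
def ForecastModel.lossGradient {D LC LF : ℕ} (f : ForecastModel.{u} D LC LF)
    (θ : EuclideanSpace ℝ (Fin D)) (y : Fin (LC + LF) → ℝ) : EuclideanSpace ℝ (Fin D) :=
  gradient (fun θ' => f.loss (f.predict θ' fun i => y (Fin.castAdd LF i))
    fun i => y (Fin.natAdd LC i)) θ

/-- Gradient clipping `g / max {1, ‖g‖₂ / C}`. -/
def clip {D : ℕ} (C : ℝ) (g : EuclideanSpace ℝ (Fin D)) : EuclideanSpace ℝ (Fin D) :=
  (max 1 (‖g‖ / C))⁻¹ • g

section Training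

variable {L LC LF N D : ℕ} (lam Lam : ℕ) (σ : ℝ≥0) (C η : ℝ) (f : ForecastModel.{u} D LC LF)
  (x : Dataset N L)

/-- The sum of the clipped gradients over all sampled subsequences of the `b`-th batch. -/
def clippedGradientSum (b : ℕ) (θ : EuclideanSpace ℝ (Fin D))
    (m : SampleMask N L LF lam Lam b) : EuclideanSpace ℝ (Fin D) :=
  ∑ n : topLevelBatch N lam Lam b, ∑ t : Fin (numStarts L LF),
    if m n t = true then clip C (f.lossGradient θ (subsequence LC LF (x n) t)) else 0

/-- The law of the noisy gradient `g̃ = (ĝ + 𝒩(0, σ² C² I)) / Λ` of the training step on the `b`-th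
batch with current parameters `θ`. -/
def stepLaw (b : ℕ) (θ : EuclideanSpace ℝ (Fin D)) : Measure (EuclideanSpace ℝ (Fin D)) :=
  ((poissonSampling N L LF lam Lam b).prod (stdGaussian (EuclideanSpace ℝ (Fin D)))).map
    fun ω => (Lam : ℝ)⁻¹ • (clippedGradientSum lam Lam C f x b θ ω.1 + ((σ : ℝ) * C) • ω.2)

/-- The joint law of the noisy gradients of `k` successive training steps, on the batches
`b, b + 1, …, b + k - 1`, starting from the parameters `θ`: draw the first noisy gradient `g̃`,
update `θ ← θ - η g̃`, and go on with the remaining `k - 1` steps. -/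
def stepsLaw : (k b : ℕ) → EuclideanSpace ℝ (Fin D) →
    Measure (Fin k → EuclideanSpace ℝ (Fin D))
  | 0, _, _ => Measure.dirac Fin.elim0
  | k + 1, b, θ => (stepLaw lam Lam σ C f x b θ).bind fun g =>
      (stepsLaw k (b + 1) (θ - η • g)).map
        fun v => (Fin.cons g v : Fin (k + 1) → EuclideanSpace ℝ (Fin D))

/-- The mechanism of one epoch, i.e. `⌊N λ / Λ⌋` training steps from the initial parameters `θ₀`.
It releases the noisy gradients used in all steps. -/
def epochMechanism (θ₀ : EuclideanSpace ℝ (Fin D)) :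
    Measure (Fin (N * lam / Lam) → EuclideanSpace ℝ (Fin D)) :=
  stepsLaw lam Lam σ C η f x (N * lam / Lam) 0 θ₀

/-! ### The mechanism is a probability measure -/

lemma measurable_clippedGradientSum (b : ℕ) (m : SampleMask N L LF lam Lam b) :
    Measurable fun θ => clippedGradientSum lam Lam C f x b θ m := by
  have hg : ∀ y, Measurable fun θ => clip C (f.lossGradient θ y) := by
    intro y
    have h : Measurable fun θ => f.lossGradient θ y := by
      unfold ForecastModel.lossGradient gradient
      exact (LinearIsometryEquiv.continuous _).measurable.comp (measurable_fderiv ℝ _)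
    unfold clip
    fun_prop
  unfold clippedGradientSum
  refine Finset.measurable_sum _ fun n _ => Finset.measurable_sum _ fun t _ => ?_
  split_ifs
  · exact hg _
  · exact measurable_const

lemma measurable_step (b : ℕ) :
    Measurable fun q : EuclideanSpace ℝ (Fin D) ×
        (SampleMask N L LF lam Lam b × EuclideanSpace ℝ (Fin D)) =>
      (Lam : ℝ)⁻¹ • (clippedGradientSum lam Lam C f x b q.1 q.2.1 + ((σ : ℝ) * C) • q.2.2) := by
  have h : Measurable fun q : EuclideanSpace ℝ (Fin D) × SampleMask N L LF lam Lam b =>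
      clippedGradientSum lam Lam C f x b q.1 q.2 :=
    measurable_from_prod_countable_left fun m => measurable_clippedGradientSum lam Lam C f x b m
  have h' := h.comp (measurable_fst.prodMk measurable_snd.fst :
    Measurable fun q : EuclideanSpace ℝ (Fin D) ×
      (SampleMask N L LF lam Lam b × EuclideanSpace ℝ (Fin D)) => (q.1, q.2.1))
  exact (h'.add (measurable_snd.snd.const_smul ((σ : ℝ) * C))).const_smul (Lam : ℝ)⁻¹

instance (b : ℕ) : IsProbabilityMeasure (poissonSampling N L LF lam Lam b) := by
  unfold poissonSampling; infer_instance

instance (b : ℕ) (θ : EuclideanSpace ℝ (Fin D)) :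
    IsProbabilityMeasure (stepLaw lam Lam σ C f x b θ) :=
  Measure.isProbabilityMeasure_map
    ((measurable_step lam Lam σ C f x b).comp measurable_prodMk_left).aemeasurable

lemma measurable_stepLaw (b : ℕ) : Measurable (stepLaw lam Lam σ C f x b) := by
  refine Measure.measurable_of_measurable_coe _ fun s hs => ?_
  have h := measurable_step lam Lam σ C f x b
  have : ∀ θ, stepLaw lam Lam σ C f x b θ s =
      ((poissonSampling N L LF lam Lam b).prod (stdGaussian (EuclideanSpace ℝ (Fin D))))
        (Prod.mk θ ⁻¹' ((fun q : EuclideanSpace ℝ (Fin D) ×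
          (SampleMask N L LF lam Lam b × EuclideanSpace ℝ (Fin D)) => (Lam : ℝ)⁻¹ •
            (clippedGradientSum lam Lam C f x b q.1 q.2.1 + ((σ : ℝ) * C) • q.2.2)) ⁻¹' s)) :=
    fun θ => Measure.map_apply (h.comp measurable_prodMk_left) hs
  simp_rw [this]
  exact measurable_measure_prodMk_left (h hs)

lemma stepsLaw_aux (k : ℕ) : ∀ b : ℕ, Measurable (stepsLaw lam Lam σ C η f x k b) ∧
    ∀ θ, IsProbabilityMeasure (stepsLaw lam Lam σ C η f x k b θ) := by
  induction k with
  | zero => exact fun b => ⟨measurable_const, fun θ => by unfold stepsLaw; infer_instance⟩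
  | succ k ih =>
    intro b
    obtain ⟨hm, hp⟩ := ih (b + 1)
    have hcons : Measurable fun q : EuclideanSpace ℝ (Fin D) × (Fin k → EuclideanSpace ℝ (Fin D)) =>
        (Fin.cons q.1 q.2 : Fin (k + 1) → EuclideanSpace ℝ (Fin D)) := by
      refine measurable_pi_lambda _ fun i => ?_
      refine Fin.cases ?_ (fun j => ?_) i
      · exact measurable_fst
      · exact (measurable_pi_apply j).comp measurable_snd
    have hcons' : ∀ g, Measurable
        fun v : Fin k → EuclideanSpace ℝ (Fin D) =>
          (Fin.cons g v : Fin (k + 1) → EuclideanSpace ℝ (Fin D)) :=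
      fun g => hcons.comp (measurable_prodMk_left (x := g))
    let κ : Kernel (EuclideanSpace ℝ (Fin D)) (Fin k → EuclideanSpace ℝ (Fin D)) := ⟨_, hm⟩
    have : IsMarkovKernel κ := ⟨hp⟩
    let ρ : Kernel (EuclideanSpace ℝ (Fin D) × EuclideanSpace ℝ (Fin D)) _ :=
      κ.comap (fun q => q.1 - η • q.2) (by fun_prop)
    have hF : Measurable fun q : EuclideanSpace ℝ (Fin D) × EuclideanSpace ℝ (Fin D) =>
        (stepsLaw lam Lam σ C η f x k (b + 1) (q.1 - η • q.2)).map
          fun v => (Fin.cons q.2 v : Fin (k + 1) → EuclideanSpace ℝ (Fin D)) := by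
      refine Measure.measurable_of_measurable_coe _ fun s hs => ?_
      simp_rw [Measure.map_apply (hcons' _) hs]
      have h2 : Measurable fun q : (EuclideanSpace ℝ (Fin D) × EuclideanSpace ℝ (Fin D)) ×
          (Fin k → EuclideanSpace ℝ (Fin D)) =>
          (Fin.cons q.1.2 q.2 : Fin (k + 1) → EuclideanSpace ℝ (Fin D)) :=
        hcons.comp (by fun_prop : Measurable fun q : (EuclideanSpace ℝ (Fin D) ×
          EuclideanSpace ℝ (Fin D)) × (Fin k → EuclideanSpace ℝ (Fin D)) => (q.1.2, q.2))
      exact Kernel.measurable_kernel_prodMk_left (κ := ρ) (h2 hs)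
    have hF' : ∀ θ, Measurable fun g =>
        (stepsLaw lam Lam σ C η f x k (b + 1) (θ - η • g)).map
          fun v => (Fin.cons g v : Fin (k + 1) → EuclideanSpace ℝ (Fin D)) :=
      fun θ => hF.comp measurable_prodMk_left
    constructor
    · refine Measure.measurable_of_measurable_coe _ fun s hs => ?_
      unfold stepsLaw
      simp_rw [Measure.bind_apply hs (hF' _).aemeasurable]
      let τ : Kernel (EuclideanSpace ℝ (Fin D)) (EuclideanSpace ℝ (Fin D)) :=
        ⟨_, measurable_stepLaw lam Lam σ C f x b⟩
      have : IsMarkovKernel τ := ⟨fun θ => by change IsProbabilityMeasure (stepLaw ..); infer_instance⟩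
      exact Measurable.lintegral_kernel_prod_right' (κ := τ) ((Measure.measurable_coe hs).comp hF)
    · intro θ
      constructor
      unfold stepsLaw
      rw [Measure.bind_apply MeasurableSet.univ (hF' θ).aemeasurable]
      have : ∀ g, ((stepsLaw lam Lam σ C η f x k (b + 1) (θ - η • g)).map
          fun v => (Fin.cons g v : Fin (k + 1) → EuclideanSpace ℝ (Fin D))) Set.univ = 1 := by
        intro g
        rw [Measure.map_apply (hcons' _) MeasurableSet.univ, Set.preimage_univ]
        exact (hp _).measure_univ
      simp [this]

instance (θ₀ : EuclideanSpace ℝ (Fin D)) :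
    IsProbabilityMeasure (epochMechanism lam Lam σ C η f x θ₀) :=
  (stepsLaw_aux lam Lam σ C η f x _ 0).2 θ₀

end Training

end

noncomputable section

/-! For laws with `P ≪ Q`, `H_α(P ‖ Q)` is the least `H` with `P s ≤ α Q s + H` for all measurable
`s` (`measure_le_hockeyStick`, `hockeyStick_le`), so domination is a statement about tests.

Reduction to one step: the changed sequence lies in at most one batch. Steps on other batches have
the same law for both datasets, and all steps after the critical one form a common test of its
output, so `α` and `H` are paid only once (`stepsLaw_le`).

The critical step: the changed event is visible only in subsequences starting in a set `S` of size
`L_C + L_F`. Condition on the sampling outside `S`. The clipped gradients outside `S` then have a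
common sum, and those inside add a vector of norm at most `kC`, where `k` is the binomial number of
samples from `S`. After division by `σC`, both datasets yield a standard Gaussian shifted by a
vector of norm at most `k / σ`.

The heart is `exists_dominating_test`. Let a test have level `q` at the unshifted Gaussian, and let
`I` be the left half-line with `𝒩(0,1)(I) = q` (empty or the full line in the extreme cases). By
Neyman-Pearson, the power of the test at every shift of norm at most `ρ` lies between `𝒩(ρ,1)(I)`
and `𝒩(-ρ,1)(I)`. Since `I` depends neither on the shift nor on `k`, both bounds can be averaged
over `k`. This gives the two Gaussian mixtures evaluated on one set, and their own hockey-stick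
inequality finishes the step (`lintegral_stepLaw_le`).

Tightness: in `markerModel` every affected subsequence contributes a gradient of norm exactly `C`,
along a fixed axis and with opposite signs for the two datasets. The rescaled first coordinate of
the first noisy gradient then has exactly the mixture laws, and data processing gives the lower
bound (`le_privacyProfile_markerModel`). -/

/-! ### The Neyman-Pearson lemma for Gaussian shifts -/

/-- **Neyman-Pearson lemma**: the test that accepts where the likelihood ratio `q / p` is at least
`k` has the largest power among all tests of its level. -/
lemma lintegral_mul_le_setLIntegral {Ω : Type*} [MeasurableSpace Ω] {ν : Measure Ω}
    {p q ψ : Ω → ℝ≥0∞} {k : ℝ≥0∞} {I : Set Ω} (hk : k ≠ ∞) (hq : Measurable q)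
    (hψ : Measurable ψ) (hI : MeasurableSet I) (hψ1 : ∀ x, ψ x ≤ 1)
    (hpI : ∫⁻ x in I, p x ∂ν ≠ ∞) (hlevel : ∫⁻ x, p x * ψ x ∂ν = ∫⁻ x in I, p x ∂ν)
    (hmem : ∀ x ∈ I, k * p x ≤ q x) (hnot : ∀ x ∉ I, q x ≤ k * p x) :
    ∫⁻ x, q x * ψ x ∂ν ≤ ∫⁻ x in I, q x ∂ν := by
  -- This integrates `(q - k p)(1_I - ψ) ≥ 0`, rearranged without subtraction. The added terms are
  -- equal by `hlevel` and finite, so they cancel.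
  have key : ∫⁻ x, q x * ψ x ∂ν + k * ∫⁻ x in I, p x ∂ν ≤
      ∫⁻ x in I, q x ∂ν + k * ∫⁻ x in I, p x ∂ν := by
    nth_rw 2 [← hlevel]
    rw [← lintegral_indicator hI, ← lintegral_indicator hI, ← lintegral_const_mul' _ _ hk,
      ← lintegral_const_mul' _ _ hk, ← lintegral_add_left (by fun_prop),
      ← lintegral_add_left (hq.indicator hI)]
    refine lintegral_mono fun x => ?_
    by_cases hx : x ∈ I
    · simp only [Set.indicator_of_mem hx]
      obtain ⟨e, he⟩ := exists_add_of_le (hmem x hx)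
      rw [he]
      calc (k * p x + e) * ψ x + k * p x = k * p x + e * ψ x + k * (p x * ψ x) := by ring
        _ ≤ k * p x + e * 1 + k * (p x * ψ x) := by gcongr; exact hψ1 x
        _ = _ := by ring
    · simp only [Set.indicator_of_notMem hx, mul_zero, add_zero, zero_add]
      rw [← mul_assoc]
      gcongr
      exact hnot x hx
  exact (ENNReal.add_le_add_iff_right (ENNReal.mul_ne_top hk hpI)).1 key

/-- The dual form of the Neyman-Pearson lemma: the test that accepts where the likelihood ratio
`q / p` is at most `k` has the smallest power among all tests of its level. -/
lemma setLIntegral_le_lintegral_mul {Ω : Type*} [MeasurableSpace Ω] {ν : Measure Ω}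
    {p q ψ : Ω → ℝ≥0∞} {k : ℝ≥0∞} {I : Set Ω} (hk : k ≠ ∞) (hq : Measurable q)
    (hψ : Measurable ψ) (hI : MeasurableSet I) (hψ1 : ∀ x, ψ x ≤ 1)
    (hpI : ∫⁻ x in I, p x ∂ν ≠ ∞) (hlevel : ∫⁻ x, p x * ψ x ∂ν = ∫⁻ x in I, p x ∂ν)
    (hmem : ∀ x ∈ I, q x ≤ k * p x) (hnot : ∀ x ∉ I, k * p x ≤ q x) :
    ∫⁻ x in I, q x ∂ν ≤ ∫⁻ x, q x * ψ x ∂ν := by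
  have key : ∫⁻ x in I, q x ∂ν + k * ∫⁻ x in I, p x ∂ν ≤
      ∫⁻ x, q x * ψ x ∂ν + k * ∫⁻ x in I, p x ∂ν := by
    nth_rw 1 [← hlevel]
    rw [← lintegral_indicator hI, ← lintegral_indicator hI, ← lintegral_const_mul' _ _ hk,
      ← lintegral_const_mul' _ _ hk, ← lintegral_add_left (hq.indicator hI),
      ← lintegral_add_left (show Measurable fun x => q x * ψ x from hq.mul hψ)]
    refine lintegral_mono fun x => ?_
    by_cases hx : x ∈ I
    · simp only [Set.indicator_of_mem hx]
      obtain ⟨e, he⟩ := exists_add_of_le (hmem x hx)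
      calc q x + k * (p x * ψ x) = q x + (k * p x) * ψ x := by ring
        _ = q x + q x * ψ x + e * ψ x := by rw [he]; ring
        _ ≤ q x + q x * ψ x + e * 1 := by gcongr; exact hψ1 x
        _ = q x * ψ x + k * p x := by rw [he]; ring
    · simp only [Set.indicator_of_notMem hx, mul_zero, add_zero, zero_add]
      rw [← mul_assoc]
      gcongr
      exact hnot x hx
  exact (ENNReal.add_le_add_iff_right (ENNReal.mul_ne_top hk hpI)).1 key

lemma lintegral_gaussianReal (m : ℝ) (ψ : ℝ → ℝ≥0∞) :
    ∫⁻ x, ψ x ∂gaussianReal m 1 = ∫⁻ x, gaussianPDF m 1 x * ψ x := by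
  rw [gaussianReal_of_var_ne_zero _ one_ne_zero,
    lintegral_withDensity_eq_lintegral_mul_non_measurable _ (measurable_gaussianPDF m 1)
      (ae_of_all _ fun x => gaussianPDF_lt_top)]
  rfl

/-- The likelihood ratio of a shift is monotone in `x`, which is why half-lines are the optimal
tests. -/
lemma gaussianPDF_eq_mul (m x : ℝ) :
    gaussianPDF m 1 x = ENNReal.ofReal (Real.exp (m * x - m ^ 2 / 2)) * gaussianPDF 0 1 x := by
  rw [gaussianPDF, gaussianPDF, ← ENNReal.ofReal_mul (Real.exp_nonneg _), gaussianPDFReal,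
    gaussianPDFReal, mul_left_comm, ← Real.exp_add]
  congr 4
  push_cast
  ring

lemma gaussianReal_Iic_shift (m c s : ℝ) :
    gaussianReal m 1 (Set.Iic c) = gaussianReal (m + s) 1 (Set.Iic (c + s)) := by
  rw [← gaussianReal_map_add_const s, Measure.map_apply (by fun_prop) measurableSet_Iic]
  congr 1
  ext x
  simp

lemma gaussianReal_Iic_anti {m m' : ℝ} (h : m ≤ m') (c : ℝ) :
    gaussianReal m' 1 (Set.Iic c) ≤ gaussianReal m 1 (Set.Iic c) := by
  rw [gaussianReal_Iic_shift m c (m' - m), add_sub_cancel]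
  exact measure_mono (Set.Iic_subset_Iic.2 (by linarith))

/-- Intermediate value theorem for the cdf, which is continuous because there are no atoms. The
levels `0` and `1` are reached only at infinity. -/
lemma exists_gaussianReal_Iic_eq {q : ℝ≥0∞} (h0 : q ≠ 0) (h1 : q < 1) :
    ∃ c, gaussianReal 0 1 (Set.Iic c) = q := by
  set F : StieltjesFunction ℝ := cdf (gaussianReal 0 1)
  have hna := nullSingletonClass_gaussianReal (μ := 0) (v := 1) one_ne_zero
  have hF : Continuous F := by
    rw [continuous_iff_continuousAt]
    intro x
    have h := measure_singleton (μ := gaussianReal 0 1) x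
    rw [← measure_cdf (gaussianReal 0 1), StieltjesFunction.measure_singleton,
      ENNReal.ofReal_eq_zero] at h
    have hl := (cdf (gaussianReal 0 1)).mono.leftLim_le (le_refl x)
    exact (cdf (gaussianReal 0 1)).mono.continuousAt_iff_leftLim_eq_rightLim.2 (by
      rw [StieltjesFunction.rightLim_eq]; linarith)
  have hq : q.toReal ∈ Set.range F := by
    refine mem_range_of_exists_le_of_exists_ge hF ?_ ?_
    · have := (tendsto_cdf_atBot (gaussianReal 0 1)).eventually
        (gt_mem_nhds (ENNReal.toReal_pos h0 h1.ne_top))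
      exact this.exists.imp fun _ h => h.le
    · have h1' : q.toReal < 1 := by
        simpa using (ENNReal.toReal_lt_toReal h1.ne_top ENNReal.one_ne_top).2 h1
      have := (tendsto_cdf_atTop (gaussianReal 0 1)).eventually (lt_mem_nhds h1')
      exact this.exists.imp fun _ h => h.le
  obtain ⟨c, hc⟩ := hq
  refine ⟨c, ?_⟩
  rw [← ofReal_cdf, show cdf (gaussianReal 0 1) c = q.toReal from hc, ENNReal.ofReal_toReal h1.ne_top]

/-- Among all tests of level `q` for `𝒩(0, 1)`, there is a deterministic one whose power at a shift
in the negative direction is largest and whose power at a shift in the positive direction is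
smallest. -/
lemma exists_extremal_test {q : ℝ≥0∞} (hq : q ≤ 1) :
    ∃ I : Set ℝ, MeasurableSet I ∧ ∀ ψ : ℝ → ℝ≥0∞, Measurable ψ → (∀ x, ψ x ≤ 1) →
      ∫⁻ x, ψ x ∂gaussianReal 0 1 = q → ∀ s ρ : ℝ, 0 ≤ s → s ≤ ρ →
        ∫⁻ x, ψ x ∂gaussianReal (-s) 1 ≤ gaussianReal (-ρ) 1 I ∧
        gaussianReal ρ 1 I ≤ ∫⁻ x, ψ x ∂gaussianReal s 1 := by
  have hac : ∀ m, gaussianReal m 1 ≪ gaussianReal 0 1 := fun m =>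
    (gaussianReal_absolutelyContinuous m one_ne_zero).trans
      (gaussianReal_absolutelyContinuous' 0 one_ne_zero)
  rcases eq_or_ne q 0 with rfl | h0
  -- A test of level `0` vanishes almost everywhere, also under every shift, since all shifts share
  -- their null sets.
  · refine ⟨∅, MeasurableSet.empty, fun ψ hψ _ h s ρ _ _ => ⟨?_, by simp⟩⟩
    rw [lintegral_eq_zero_iff hψ] at h
    rw [lintegral_congr_ae (hac _ h)]
    simp
  rcases hq.lt_or_eq with h1 | rfl
  · obtain ⟨c, hc⟩ := exists_gaussianReal_Iic_eq h0 h1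
    refine ⟨Set.Iic c, measurableSet_Iic, fun ψ hψ hψ1 h s ρ hs hsρ => ⟨?_, ?_⟩⟩
    · refine le_trans ?_ (gaussianReal_Iic_anti (neg_le_neg hsρ) c)
      rw [lintegral_gaussianReal, gaussianReal_apply _ one_ne_zero]
      rw [← hc, lintegral_gaussianReal, gaussianReal_apply _ one_ne_zero] at h
      -- `k` is the likelihood ratio at the threshold `c`. For the shift `-s` the ratio decreases in
      -- `x`, so `Iic c` is the region of large ratio.
      refine lintegral_mul_le_setLIntegral
        (k := ENNReal.ofReal (Real.exp (-s * c - (-s) ^ 2 / 2))) ENNReal.ofReal_ne_top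
        (measurable_gaussianPDF _ 1) hψ measurableSet_Iic hψ1 ?_ h
        ?_ ?_
      · rw [← gaussianReal_apply _ one_ne_zero]; exact measure_ne_top _ _
      · intro x hx
        rw [gaussianPDF_eq_mul (-s)]
        gcongr ENNReal.ofReal (Real.exp (?_ - _)) * _
        exact mul_le_mul_of_nonpos_left hx (by linarith)
      · intro x hx
        rw [gaussianPDF_eq_mul (-s)]
        gcongr ENNReal.ofReal (Real.exp (?_ - _)) * _
        exact mul_le_mul_of_nonpos_left (not_le.1 hx).le (by linarith)
    · refine (gaussianReal_Iic_anti hsρ c).trans ?_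
      rw [lintegral_gaussianReal, gaussianReal_apply _ one_ne_zero]
      rw [← hc, lintegral_gaussianReal, gaussianReal_apply _ one_ne_zero] at h
      -- For the shift `s` the ratio increases in `x`, so the same half-line is now the least
      -- powerful test.
      refine setLIntegral_le_lintegral_mul
        (k := ENNReal.ofReal (Real.exp (s * c - s ^ 2 / 2))) ENNReal.ofReal_ne_top
        (measurable_gaussianPDF _ 1) hψ measurableSet_Iic hψ1 ?_ h
        ?_ ?_
      · rw [← gaussianReal_apply _ one_ne_zero]; exact measure_ne_top _ _
      · intro x hx
        rw [gaussianPDF_eq_mul s]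
        gcongr ENNReal.ofReal (Real.exp (_ * ?_ - _)) * _
        exact hx
      · intro x hx
        rw [gaussianPDF_eq_mul s]
        gcongr ENNReal.ofReal (Real.exp (_ * ?_ - _)) * _
        exact (not_le.1 hx).le
  · refine ⟨Set.univ, MeasurableSet.univ, fun ψ hψ hψ1 h s ρ _ _ => ⟨?_, ?_⟩⟩
    · rw [measure_univ]
      calc ∫⁻ x, ψ x ∂gaussianReal (-s) 1 ≤ ∫⁻ _, 1 ∂gaussianReal (-s) 1 := lintegral_mono hψ1
        _ = 1 := by simp
    · have h' : ψ =ᵐ[gaussianReal 0 1] fun _ => 1 :=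
        ae_eq_of_ae_le_of_lintegral_le (ae_of_all _ hψ1) (by simp [h]) aemeasurable_const
          (by simp [h])
      rw [lintegral_congr_ae (hac _ h')]
      simp

/-! ### Tests for shifts of the standard Gaussian distribution -/

section stdGaussian

variable {E : Type*} [NormedAddCommGroup E] [InnerProductSpace ℝ E] [FiniteDimensional ℝ E]
  [MeasurableSpace E] [BorelSpace E]

open scoped RealInnerProductSpace in
/-- Resampling the component of a standard Gaussian vector in a fixed direction does not change its
distribution. -/
lemma stdGaussian_eq_map_prod {e : E} (he : ‖e‖ = 1) :
    stdGaussian E = ((gaussianReal 0 1).prod (stdGaussian E)).map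
      fun q => q.2 + (q.1 - ⟪e, q.2⟫) • e := by
  have hm : Measurable fun q : ℝ × E => q.2 + (q.1 - ⟪e, q.2⟫) • e := by fun_prop
  have := Measure.isProbabilityMeasure_map (μ := (gaussianReal 0 1).prod (stdGaussian E))
    hm.aemeasurable
  refine Measure.ext_of_charFun ?_
  ext t
  have h1 : ∀ q : ℝ × E, ⟪q.2 + (q.1 - ⟪e, q.2⟫) • e, t⟫ =
      q.1 * ⟪e, t⟫ + ⟪q.2, t - ⟪e, t⟫ • e⟫ := by
    intro q
    simp only [inner_add_left, inner_smul_left, inner_sub_right, inner_smul_right,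
      real_inner_comm q.2 e]
    simp
    ring
  -- Pythagoras: the characteristic function splits into the factor along `e` and the orthogonal
  -- factor, and their exponents add up to `-‖t‖² / 2`.
  have h2 : ‖t - ⟪e, t⟫ • e‖ ^ 2 = ‖t‖ ^ 2 - ⟪e, t⟫ ^ 2 := by
    rw [norm_sub_sq_real, inner_smul_right, norm_smul, he, real_inner_comm e t, mul_one,
      Real.norm_eq_abs, sq_abs]
    ring
  conv_rhs => rw [charFun_apply, integral_map hm.aemeasurable (by fun_prop)]
  simp_rw [h1]
  have h3 : ∀ q : ℝ × E, Complex.exp (((q.1 * ⟪e, t⟫ + ⟪q.2, t - ⟪e, t⟫ • e⟫ : ℝ) : ℂ) * Complex.I) =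
      Complex.exp (((⟪e, t⟫ : ℝ) : ℂ) * q.1 * Complex.I) *
        Complex.exp ((⟪q.2, t - ⟪e, t⟫ • e⟫ : ℝ) * Complex.I) := by
    intro q
    rw [← Complex.exp_add]
    congr 1
    push_cast
    ring
  simp_rw [h3]
  rw [integral_prod_mul (fun ξ : ℝ => Complex.exp (((⟪e, t⟫ : ℝ) : ℂ) * ξ * Complex.I))
    (fun z : E => Complex.exp ((⟪z, t - ⟪e, t⟫ • e⟫ : ℝ) * Complex.I)), ← charFun_apply_real,
    ← charFun_apply, charFun_gaussianReal, charFun_stdGaussian, charFun_stdGaussian,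
    ← Complex.exp_add]
  congr 1
  rw [← Complex.ofReal_pow ‖t - _‖, h2]
  push_cast
  ring

open scoped RealInnerProductSpace in
/-- The average of a test over the components orthogonal to `e`. -/
lemma exists_marginal_test {φ : E → ℝ≥0∞} (hφ : Measurable φ) (hφ1 : ∀ z, φ z ≤ 1) {e : E}
    (he : ‖e‖ = 1) :
    ∃ ψ : ℝ → ℝ≥0∞, Measurable ψ ∧ (∀ x, ψ x ≤ 1) ∧
      ∀ s : ℝ, ∫⁻ z, φ (z + s • e) ∂stdGaussian E = ∫⁻ x, ψ x ∂gaussianReal s 1 := by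
  have hm : Measurable fun q : ℝ × E => q.2 + (q.1 - ⟪e, q.2⟫) • e := by fun_prop
  have hψ : Measurable fun x : ℝ => ∫⁻ z, φ (z + (x - ⟪e, z⟫) • e) ∂stdGaussian E :=
    (hφ.comp hm).lintegral_prod_right'
  refine ⟨_, hψ, fun x => ?_, fun s => ?_⟩
  · calc ∫⁻ z, φ (z + (x - ⟪e, z⟫) • e) ∂stdGaussian E ≤ ∫⁻ _, 1 ∂stdGaussian E :=
          lintegral_mono fun _ => hφ1 _
      _ = 1 := by simp
  · have hs : Measurable fun z : E => φ (z + s • e) := hφ.comp (by fun_prop)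
    rw [← zero_add s, ← gaussianReal_map_add_const s, lintegral_map hψ (by fun_prop)]
    conv_lhs => rw [stdGaussian_eq_map_prod he, zero_add, lintegral_map hs hm,
      lintegral_prod (fun q : ℝ × E => φ (q.2 + (q.1 - ⟪e, q.2⟫) • e + s • e))
        (hs.comp hm).aemeasurable]
    refine lintegral_congr fun x => lintegral_congr fun z => ?_
    congr 1
    module

/-- A test for the standard Gaussian distribution is dominated by a test for `𝒩(0, 1)`, uniformly
in the shifts of bounded norm. -/
lemma exists_dominating_test {φ : E → ℝ≥0∞} (hφ : Measurable φ) (hφ1 : ∀ z, φ z ≤ 1) :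
    ∃ I : Set ℝ, MeasurableSet I ∧ ∀ (u : E) (ρ : ℝ), ‖u‖ ≤ ρ →
      ∫⁻ z, φ (z + u) ∂stdGaussian E ≤ gaussianReal (-ρ) 1 I ∧
      gaussianReal ρ 1 I ≤ ∫⁻ z, φ (z + u) ∂stdGaussian E := by
  have hq : ∫⁻ z, φ z ∂stdGaussian E ≤ 1 :=
    calc ∫⁻ z, φ z ∂stdGaussian E ≤ ∫⁻ _, 1 ∂stdGaussian E := lintegral_mono hφ1
      _ = 1 := by simp
  obtain ⟨I, hI, h⟩ := exists_extremal_test hq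
  refine ⟨I, hI, fun u ρ hu => ?_⟩
  rcases eq_or_ne u 0 with rfl | hu0
  -- There is no direction to normalise here. The constant test has the same level, and its power at
  -- shift `0` is that level.
  · have := h (fun _ => ∫⁻ z, φ z ∂stdGaussian E) measurable_const (fun _ => hq) (by simp) 0 ρ
      le_rfl (by simpa using hu)
    simpa using this
  · have hn : ‖u‖ ≠ 0 := norm_ne_zero_iff.2 hu0
    have he : ‖(‖u‖⁻¹ • u)‖ = 1 := by rw [norm_smul, norm_inv, norm_norm, inv_mul_cancel₀ hn]
    have he' : ‖-(‖u‖⁻¹ • u)‖ = 1 := by rw [norm_neg, he]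
    constructor
    -- Along `-u / ‖u‖` the shift `u` is negative, as the upper bound requires. The marginal test
    -- depends on the direction but its level does not, so one `I` serves all `u`.
    · obtain ⟨ψ, hψ, hψ1, hs⟩ := exists_marginal_test hφ hφ1 he'
      have h0 := hs 0
      have h1 := hs (-‖u‖)
      rw [neg_smul_neg, smul_inv_smul₀ hn] at h1
      simp only [zero_smul, add_zero] at h0
      rw [h1]
      exact (h ψ hψ hψ1 h0.symm ‖u‖ ρ (norm_nonneg u) hu).1
    · obtain ⟨ψ, hψ, hψ1, hs⟩ := exists_marginal_test hφ hφ1 he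
      have h0 := hs 0
      have h1 := hs ‖u‖
      rw [smul_inv_smul₀ hn] at h1
      simp only [zero_smul, add_zero] at h0
      rw [h1]
      exact (h ψ hψ hψ1 h0.symm ‖u‖ ρ (norm_nonneg u) hu).2

/-- A null set of a shift of the standard Gaussian distribution is a null set of every shift. -/
lemma stdGaussian_shift_null {s : Set E} (hs : MeasurableSet s) (u : E)
    (h : stdGaussian E s = 0) : stdGaussian E ((fun z => z + u) ⁻¹' s) = 0 := by
  rcases eq_or_ne u 0 with rfl | hu0
  · simpa using h
  have hn : ‖u‖ ≠ 0 := norm_ne_zero_iff.2 hu0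
  have he : ‖(‖u‖⁻¹ • u)‖ = 1 := by rw [norm_smul, norm_inv, norm_norm, inv_mul_cancel₀ hn]
  -- The marginal along `u` reduces the claim to the mutual absolute continuity of Gaussians on the
  -- line.
  obtain ⟨ψ, hψ, -, hψs⟩ := exists_marginal_test (φ := s.indicator 1)
    (measurable_one.indicator hs) (fun z => by
      by_cases hz : z ∈ s
      · simp [hz]
      · simp [hz]) he
  have h0 := hψs 0
  have h1 := hψs ‖u‖
  rw [smul_inv_smul₀ hn] at h1
  simp only [zero_smul, add_zero, lintegral_indicator_one hs, h] at h0
  have h2 : ∫⁻ z, s.indicator (1 : E → ℝ≥0∞) (z + u) ∂stdGaussian E =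
      stdGaussian E ((fun z => z + u) ⁻¹' s) := by
    rw [← lintegral_indicator_one (hs.preimage (by fun_prop))]
    rfl
  rw [← h2, h1, lintegral_eq_zero_iff hψ]
  exact ((gaussianReal_absolutelyContinuous _ one_ne_zero).trans
    (gaussianReal_absolutelyContinuous' 0 one_ne_zero)) ((lintegral_eq_zero_iff hψ).1 h0.symm)

end stdGaussian

/-! ### Hockey-stick divergences and tests -/

section hockeyStick

variable {Ω : Type*} [MeasurableSpace Ω] {P Q : Measure Ω} {α : ℝ≥0}

/-- No test gains more than the hockey-stick divergence. `P ≪ Q` matters because `rnDeriv` does not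
see a singular part of `P`. -/
lemma lintegral_le_hockeyStick [SigmaFinite P] [SigmaFinite Q] (hPQ : P ≪ Q)
    {φ : Ω → ℝ≥0∞} (hφ : Measurable φ) (hφ1 : ∀ x, φ x ≤ 1) :
    ∫⁻ x, φ x ∂P ≤ α * ∫⁻ x, φ x ∂Q + hockeyStick α P Q := by
  rw [hockeyStick, ← lintegral_rnDeriv_mul hPQ hφ.aemeasurable,
    ← lintegral_const_mul _ hφ, ← lintegral_add_left (by fun_prop)]
  refine lintegral_mono fun x => ?_
  calc P.rnDeriv Q x * φ x ≤ (α + (P.rnDeriv Q x - α)) * φ x := by gcongr; exact le_add_tsub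
    _ = α * φ x + (P.rnDeriv Q x - α) * φ x := add_mul _ _ _
    _ ≤ α * φ x + (P.rnDeriv Q x - α) * 1 := by gcongr; exact hφ1 x
    _ = _ := by rw [mul_one]

lemma measure_le_hockeyStick [SigmaFinite P] [SigmaFinite Q] (hPQ : P ≪ Q) {s : Set Ω}
    (hs : MeasurableSet s) : P s ≤ α * Q s + hockeyStick α P Q := by
  have h := lintegral_le_hockeyStick (α := α) hPQ (measurable_one.indicator hs) fun x =>
    Set.indicator_le_self s 1 x
  rwa [lintegral_indicator_one hs, lintegral_indicator_one hs] at h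

/-- The divergence is attained on the set `dP/dQ > α`, where the truncated difference is a genuine
one. Absolute continuity is not needed, since integrating the density can only undercount `P s`. -/
lemma hockeyStick_le [IsFiniteMeasure P] [IsFiniteMeasure Q] {H : ℝ≥0∞}
    (h : ∀ s, MeasurableSet s → P s ≤ α * Q s + H) : hockeyStick α P Q ≤ H := by
  have hs : MeasurableSet {x | (α : ℝ≥0∞) < P.rnDeriv Q x} :=
    measurableSet_lt measurable_const (Measure.measurable_rnDeriv P Q)
  set s := {x | (α : ℝ≥0∞) < P.rnDeriv Q x}
  have h1 : hockeyStick α P Q = ∫⁻ x in s, (P.rnDeriv Q x - α) ∂Q := by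
    rw [hockeyStick, ← lintegral_indicator hs]
    refine lintegral_congr fun x => ?_
    by_cases hx : x ∈ s
    · rw [Set.indicator_of_mem hx]
    · rw [Set.indicator_of_notMem hx, tsub_eq_zero_of_le (not_lt.1 hx)]
  have h2 : hockeyStick α P Q + α * Q s ≤ P s := by
    rw [h1, ← setLIntegral_const, ← lintegral_add_right _ measurable_const]
    refine le_trans (le_of_eq ?_) (Measure.setLIntegral_rnDeriv_le (ν := Q) s)
    exact setLIntegral_congr_fun hs fun x hx => tsub_add_cancel_of_le (le_of_lt hx)
  have h3 := h2.trans (h s hs)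
  rw [add_comm] at h3
  exact (ENNReal.add_le_add_iff_left
    (ENNReal.mul_ne_top ENNReal.coe_ne_top (measure_ne_top Q s))).1 h3

/-- The data-processing inequality. -/
lemma hockeyStick_map_le {Ω' : Type*} [MeasurableSpace Ω'] [IsFiniteMeasure P] [IsFiniteMeasure Q]
    (hPQ : P ≪ Q) {g : Ω → Ω'} (hg : Measurable g) :
    hockeyStick α (P.map g) (Q.map g) ≤ hockeyStick α P Q := by
  refine hockeyStick_le fun s hs => ?_
  rw [Measure.map_apply hg hs, Measure.map_apply hg hs]
  exact measure_le_hockeyStick hPQ (hg hs)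

end hockeyStick

/-! ### Mixtures of Gaussians -/

section MoG

variable {K : ℕ} {μ μ' p : Fin K → ℝ} {σ : ℝ≥0}

lemma MoG_apply (s : Set ℝ) :
    MoG μ p σ s = ∑ k, ENNReal.ofReal (p k) * gaussianReal (μ k) (σ ^ 2) s := by
  simp [MoG, Measure.finsetSum_apply]

lemma isProbabilityMeasure_MoG (hp0 : ∀ k, 0 ≤ p k) (hp : ∑ k, p k = 1) :
    IsProbabilityMeasure (MoG μ p σ) := by
  constructor
  simp [MoG_apply, ← ENNReal.ofReal_sum_of_nonneg fun k _ => hp0 k, hp]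

lemma MoG_absolutelyContinuous (hσ : 0 < σ) : MoG μ p σ ≪ MoG μ' p σ := by
  intro s hs
  have hv : σ ^ 2 ≠ 0 := by positivity
  rw [MoG_apply] at hs ⊢
  simp only [Finset.sum_eq_zero_iff, Finset.mem_univ, true_imp_iff, mul_eq_zero] at hs ⊢
  exact fun k => (hs k).imp id fun h => (gaussianReal_absolutelyContinuous _ hv).trans
    (gaussianReal_absolutelyContinuous' _ hv) h

end MoG

lemma gaussianReal_preimage_div {σ : ℝ≥0} (hσ : 0 < σ) (m : ℝ) {I : Set ℝ} (hI : MeasurableSet I) :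
    gaussianReal m (σ ^ 2) ((fun x => x / σ) ⁻¹' I) = gaussianReal (m / σ) 1 I := by
  have h := gaussianReal_map_div_const (μ := m) (v := σ ^ 2) (σ : ℝ)
  rw [← Measure.map_apply (by fun_prop) hI, h]
  congr 2
  have h2 : σ ≠ 0 := hσ.ne'
  ext
  push_cast
  exact div_self (by positivity)

/-! ### Bottom-level Poisson sampling -/

/-- Resampling some of the entries of an array of independent identically distributed random
variables does not change its distribution. -/
lemma lintegral_pi_pi_resample {ι κ β : Type*} [Fintype ι] [Fintype κ] [Finite β]
    [MeasurableSpace β] [MeasurableSingletonClass β] (ν : Measure β) [IsProbabilityMeasure ν]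
    (p : ι → κ → Prop) [∀ i j, Decidable (p i j)] (F : (ι → κ → β) → ℝ≥0∞) :
    ∫⁻ m, F m ∂(Measure.pi fun _ => Measure.pi fun _ => ν) =
      ∫⁻ m, ∫⁻ a, F (fun i j => if p i j then a i j else m i j)
        ∂(Measure.pi fun _ => Measure.pi fun _ => ν)
        ∂(Measure.pi fun _ => Measure.pi fun _ => ν) := by
  set π : Measure (ι → κ → β) := Measure.pi fun _ => Measure.pi fun _ => ν with hπ
  have hmap : (π.prod π).map (fun q : (ι → κ → β) × (ι → κ → β) =>
      fun i j => if p i j then q.2 i j else q.1 i j) = π := by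
    refine Measure.ext_of_singleton fun m₀ => ?_
    rw [Measure.map_apply .of_discrete (measurableSet_singleton m₀)]
    -- All spaces are finite and discrete, so singletons suffice. The preimage of one is a rectangle
    -- in which each entry is constrained in exactly one of the two arrays.
    have hpre : (fun q : (ι → κ → β) × (ι → κ → β) =>
        fun i j => if p i j then q.2 i j else q.1 i j) ⁻¹' {m₀} =
        (Set.univ.pi fun i => Set.univ.pi fun j => if p i j then Set.univ else {m₀ i j}) ×ˢ
        (Set.univ.pi fun i => Set.univ.pi fun j => if p i j then {m₀ i j} else Set.univ) := by
      ext q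
      simp only [Set.mem_preimage, Set.mem_singleton_iff, funext_iff, Set.mem_prod, Set.mem_pi,
        Set.mem_univ, true_imp_iff, ← forall_and]
      refine forall_congr' fun i => forall_congr' fun j => ?_
      split_ifs <;> simp
    have hsing : ({m₀} : Set (ι → κ → β)) =
        Set.univ.pi fun i => Set.univ.pi fun j => {m₀ i j} := by
      ext q
      simp [funext_iff]
    rw [hpre, hsing, Measure.prod_prod, hπ]
    simp only [Measure.pi_pi, ← Finset.prod_mul_distrib]
    refine Finset.prod_congr rfl fun i _ => Finset.prod_congr rfl fun j _ => ?_
    split_ifs <;> simp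
  conv_lhs => rw [← hmap, lintegral_map .of_discrete .of_discrete]
  exact lintegral_prod _ Measurable.of_discrete.aemeasurable

lemma map_card_pi_bernoulliMeasure {κ : Type*} [Fintype κ] [DecidableEq κ] (S : Finset κ)
    (r : unitInterval) :
    (Measure.pi fun _ : κ => bernoulliMeasure true false r).map
      (fun a => (S.filter fun t => a t = true).card) = binomial S.card r := by
  refine Measure.ext_of_singleton fun k => ?_
  rw [Measure.map_apply .of_discrete (measurableSet_singleton k), binomial_singleton]
  -- Split by the set `U` of sampled elements of `S`: these cylinders are disjoint and equally
  -- likely, and `binomial S.card r` counts them.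
  have hpre : (fun a : κ → Bool => (S.filter fun t => a t = true).card) ⁻¹' {k} =
      ⋃ U ∈ S.powersetCard k, Set.univ.pi fun t =>
        if t ∈ U then {true} else if t ∈ S then {false} else Set.univ := by
    ext a
    simp only [Set.mem_preimage, Set.mem_singleton_iff, Set.mem_iUnion, Set.mem_pi, Set.mem_univ,
      true_imp_iff, exists_prop, Finset.mem_powersetCard]
    constructor
    · intro h
      refine ⟨S.filter fun t => a t = true, ⟨Finset.filter_subset _ _, h⟩, fun t => ?_⟩
      by_cases h1 : t ∈ S <;> by_cases h2 : a t = true <;> simp [h1, h2]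
    · rintro ⟨U, ⟨hU, rfl⟩, h⟩
      congr 1
      ext t
      have ht := h t
      by_cases h1 : t ∈ U
      · simp_all [hU h1]
      · by_cases h2 : t ∈ S <;> simp_all
  rw [hpre, measure_biUnion_finset]
  · have hU : ∀ U ∈ S.powersetCard k, (Measure.pi fun _ : κ => bernoulliMeasure true false r)
        (Set.univ.pi fun t => if t ∈ U then {true} else if t ∈ S then {false} else Set.univ) =
        ENNReal.ofReal ((r : ℝ) ^ k * (1 - r) ^ (S.card - k)) := by
      intro U hU
      obtain ⟨hUS, hUk⟩ := Finset.mem_powersetCard.1 hU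
      have h1 : ∀ t, bernoulliMeasure true false r
          (if t ∈ U then {true} else if t ∈ S then {false} else Set.univ) =
          (if t ∈ U then ENNReal.ofReal r else 1) *
            (if t ∈ S \ U then ENNReal.ofReal (1 - r) else 1) := by
        intro t
        by_cases h1 : t ∈ U
        · simp [h1, hUS h1]
          exact (ENNReal.ofReal_eq_coe_nnreal _).symm
        · by_cases h2 : t ∈ S
          · simp [h1, h2]
            exact (ENNReal.ofReal_eq_coe_nnreal _).symm
          · simp [h1, h2]
      rw [Measure.pi_pi, Finset.prod_congr rfl fun t _ => h1 t, Finset.prod_mul_distrib,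
        Finset.prod_ite_mem, Finset.prod_ite_mem, Finset.univ_inter, Finset.univ_inter,
        Finset.prod_const, Finset.prod_const, Finset.card_sdiff_of_subset hUS, hUk,
        ← ENNReal.ofReal_pow r.2.1, ← ENNReal.ofReal_pow (by linarith [r.2.2]),
        ← ENNReal.ofReal_mul (pow_nonneg r.2.1 k)]
    rw [Finset.sum_congr rfl hU, Finset.sum_const, Finset.card_powersetCard, nsmul_eq_mul,
      mul_assoc, ENNReal.ofReal_mul (Nat.cast_nonneg _), ENNReal.ofReal_natCast]
  · intro U hU V hV hUV
    rw [Function.onFun, Set.disjoint_left]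
    intro a haU haV
    refine hUV ?_
    ext t
    have h1 := haU t trivial
    have h2 := haV t trivial
    have hUS := (Finset.mem_powersetCard.1 hU).1
    have hVS := (Finset.mem_powersetCard.1 hV).1
    by_cases hu : t ∈ U <;> by_cases hv : t ∈ V
    · simp [hu, hv]
    · simp [hu, hv, hUS hu] at h1 h2; simp [h1] at h2
    · simp [hu, hv, hVS hv] at h1 h2; simp [h1] at h2
    · simp [hu, hv]
  · exact fun U _ => .of_discrete

lemma lintegral_binomial (K : ℕ) (r : unitInterval) (F : ℕ → ℝ≥0∞) :
    ∫⁻ k, F k ∂binomial K r =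
      ∑ k : Fin (K + 1), ENNReal.ofReal ((binomial K r).real {(k : ℕ)}) * F k := by
  conv_lhs => rw [binomial_eq_sum_dirac]
  rw [lintegral_finsetSum_measure, Fin.sum_univ_eq_sum_range
    (fun k => ENNReal.ofReal ((binomial K r).real {k}) * F k), Nat.range_succ_eq_Iic]
  refine Finset.sum_congr rfl fun k _ => ?_
  rw [lintegral_smul_measure, lintegral_dirac, binomial_real_singleton, smul_eq_mul]

lemma sum_binomial_real (K : ℕ) (r : unitInterval) :
    ∑ k : Fin (K + 1), (binomial K r).real {(k : ℕ)} = 1 := by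
  have h := lintegral_binomial K r fun _ => 1
  simp only [mul_one, lintegral_const, measure_univ] at h
  rw [← ENNReal.ofReal_sum_of_nonneg fun k _ => measureReal_nonneg] at h
  exact ENNReal.ofReal_eq_one.1 h.symm

/-- The number of subsequences of the `n`-th sequence that are sampled from a set `S` of start
indices is binomially distributed. -/
lemma lintegral_card_poissonSampling {N L LF lam Lam b : ℕ} (n : topLevelBatch N lam Lam b)
    (S : Finset (Fin (numStarts L LF))) (F : ℕ → ℝ≥0∞) :
    ∫⁻ m, F ((S.filter fun t => m n t = true).card) ∂poissonSampling N L LF lam Lam b =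
      ∑ k : Fin (S.card + 1),
        ENNReal.ofReal ((binomial S.card (samplingRate L LF lam)).real {(k : ℕ)}) * F k := by
  rw [← lintegral_binomial, ← map_card_pi_bernoulliMeasure S,
    lintegral_map .of_discrete .of_discrete]
  exact (measurePreserving_eval (fun _ : topLevelBatch N lam Lam b =>
    Measure.pi fun _ : Fin (numStarts L LF) =>
      bernoulliMeasure true false (samplingRate L LF lam)) n).lintegral_comp
    (f := fun a => F ((S.filter fun t => a t = true).card)) .of_discrete

/-! ### The neighboring datasets differ in few subsequences -/

lemma subsequence_apply (LC LF : ℕ) {L : ℕ} (a : Fin L → ℝ) (t : Fin (numStarts L LF))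
    (i : Fin (LC + LF)) :
    subsequence LC LF a t i = if h : LC ≤ (t : ℕ) + i then a ⟨t + i - LC, by
      have ht := t.isLt; have := i.isLt; unfold numStarts at ht; omega⟩ else 0 := by
  unfold subsequence Fin.append Fin.addCases
  split_ifs with h1 h2 h2
  · simp only at h1; omega
  · rfl
  · simp only [eq_rec_constant]; rfl
  · simp only at h1; omega

/-- If two sequences differ in a single time index, then at most `L_C + L_F` subsequences differ. -/
lemma exists_card_eq_subsequence_eq {L LC LF : ℕ} (hL : LC + LF ≤ L + 1 - LF) {a a' : Fin L → ℝ}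
    {t₀ : Fin L} (h : ∀ s, a s ≠ a' s → s = t₀) :
    ∃ S : Finset (Fin (numStarts L LF)), S.card = LC + LF ∧
      ∀ t ∉ S, subsequence LC LF a t = subsequence LC LF a' t := by
  -- The starts whose window covers position `LC + t₀`, where the changed event sits after padding.
  let A : Finset (Fin (numStarts L LF)) :=
    Finset.univ.filter fun t => (t : ℕ) ≤ LC + t₀ ∧ LC + t₀ < t + (LC + LF)
  have hA : A.card ≤ LC + LF := by
    rw [← Finset.card_range (LC + LF)]
    refine Finset.card_le_card_of_injOn (fun t => LC + t₀ - t) (fun t ht => ?_)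
      fun t ht t' ht' htt => ?_
    · simp only [A, Finset.coe_filter, Finset.mem_univ, true_and, Set.mem_ofPred_eq] at ht
      simp only [Finset.coe_range, Set.mem_Iio]
      omega
    · simp only [A, Finset.coe_filter, Finset.mem_univ, true_and, Set.mem_ofPred_eq] at ht ht'
      simp only at htt
      ext
      omega
  -- Events near either end may be covered by fewer windows. Enlarging to exactly `LC + LF` starts,
  -- possible by `hL`, makes the count exactly binomial for every event.
  obtain ⟨S, hAS, hS⟩ := Finset.exists_superset_card_eq hA (by
    rw [Fintype.card_fin]; exact hL)
  refine ⟨S, hS, fun t ht => ?_⟩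
  ext i
  rw [subsequence_apply, subsequence_apply]
  split_ifs with hi
  · by_contra hne
    have h1 := congrArg Fin.val (h _ hne)
    simp only at h1
    refine ht (hAS ?_)
    simp only [A, Finset.mem_filter, Finset.mem_univ, true_and]
    have := i.isLt
    omega
  · rfl

/-! ### Clipped gradients -/

lemma norm_clip_le {D : ℕ} {C : ℝ} (hC : 0 < C) (g : EuclideanSpace ℝ (Fin D)) :
    ‖clip C g‖ ≤ C := by
  have h1 : 0 < max 1 (‖g‖ / C) := lt_max_of_lt_left one_pos
  rw [clip, norm_smul, norm_inv, Real.norm_of_nonneg h1.le, inv_mul_le_iff₀ h1]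
  calc ‖g‖ = ‖g‖ / C * C := by field_simp
    _ ≤ _ := by gcongr; exact le_max_right _ _

lemma norm_sum_ite_le {κ V : Type*} [SeminormedAddCommGroup V] {C : ℝ} (S : Finset κ)
    (a : κ → Bool) {g : κ → V} (hg : ∀ t, ‖g t‖ ≤ C) :
    ‖∑ t ∈ S, if a t = true then g t else 0‖ ≤ (S.filter fun t => a t = true).card * C := by
  rw [← Finset.sum_filter, ← nsmul_eq_mul]
  exact (norm_sum_le_of_le _ fun t _ => hg t).trans (by simp)

/-- Separates the sum into a rest that depends only on `m` and a part that depends only on the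
resampled row `a n`, so that one can be fixed while the other is averaged. -/
lemma sum_sum_resample {ι κ V : Type*} [Fintype ι] [Fintype κ] [DecidableEq ι] [DecidableEq κ]
    [AddCommMonoid V] (n : ι) (S : Finset κ) (a m : ι → κ → Bool) (G : ι → κ → V) :
    (∑ i, ∑ j, if (if i = n ∧ j ∈ S then a i j else m i j) = true then G i j else 0) =
      (∑ i, ∑ j, if i = n ∧ j ∈ S then 0 else if m i j = true then G i j else 0) +
        ∑ j ∈ S, if a n j = true then G n j else 0 := by
  have h1 : (∑ j ∈ S, if a n j = true then G n j else 0) =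
      ∑ i, ∑ j, if i = n ∧ j ∈ S then (if a i j = true then G i j else 0) else 0 := by
    rw [Finset.sum_eq_single n]
    · simp [← Finset.sum_filter]
    · intro i _ hi; simp [hi]
    · simp
  rw [h1, ← Finset.sum_add_distrib]
  refine Finset.sum_congr rfl fun i _ => ?_
  rw [← Finset.sum_add_distrib]
  refine Finset.sum_congr rfl fun j _ => ?_
  split_ifs <;> simp

section Training

variable {L LC LF N D : ℕ} {lam Lam : ℕ} {σ : ℝ≥0} {C η : ℝ} {f : ForecastModel.{u} D LC LF}
  {x x' : Dataset N L}

/-! ### A single training step -/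

lemma lintegral_stepLaw {b : ℕ} {θ : EuclideanSpace ℝ (Fin D)}
    {φ : EuclideanSpace ℝ (Fin D) → ℝ≥0∞} (hφ : Measurable φ) :
    ∫⁻ g, φ g ∂stepLaw lam Lam σ C f x b θ =
      ∫⁻ m, ∫⁻ z, φ ((Lam : ℝ)⁻¹ • (clippedGradientSum lam Lam C f x b θ m + ((σ : ℝ) * C) • z))
        ∂stdGaussian (EuclideanSpace ℝ (Fin D)) ∂poissonSampling N L LF lam Lam b := by
  have hm := (measurable_step lam Lam σ C f x b).comp (measurable_prodMk_left (x := θ))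
  rw [Function.comp_def] at hm
  rw [stepLaw, lintegral_map hφ hm]
  exact lintegral_prod _ (hφ.comp hm).aemeasurable

/-- A training step on the batch that contains the sequence in which two neighboring datasets
differ is dominated by the mixtures of Gaussians with binomial weights. -/
lemma lintegral_stepLaw_le (hσ : 0 < σ) (hC : 0 < C) {b : ℕ} (n : topLevelBatch N lam Lam b)
    (hx : ∀ m : Fin N, m ≠ n → x m = x' m) (S : Finset (Fin (numStarts L LF)))
    (hS : ∀ t ∉ S, subsequence LC LF (x n) t = subsequence LC LF (x' n) t)
    (θ : EuclideanSpace ℝ (Fin D)) (α : ℝ≥0) {φ : EuclideanSpace ℝ (Fin D) → ℝ≥0∞}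
    (hφ : Measurable φ) (hφ1 : ∀ g, φ g ≤ 1)
    (p : Fin (S.card + 1) → ℝ)
    (hp : ∀ i, p i = (binomial S.card (samplingRate L LF lam)).real {(i : ℕ)}) :
    ∫⁻ g, φ g ∂stepLaw lam Lam σ C f x b θ ≤
      α * ∫⁻ g, φ g ∂stepLaw lam Lam σ C f x' b θ +
        hockeyStick α (MoG (fun i => -((i : ℕ) : ℝ)) p σ) (MoG (fun i => ((i : ℕ) : ℝ)) p σ) := by
  classical
  set H := hockeyStick α (MoG (fun i => -((i : ℕ) : ℝ)) p σ) (MoG (fun i => ((i : ℕ) : ℝ)) p σ)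
  have hσ' : (0 : ℝ) < σ := hσ
  have hσC : (σ : ℝ) * C ≠ 0 := (mul_pos hσ' hC).ne'
  let G : Dataset N L → topLevelBatch N lam Lam b → Fin (numStarts L LF) →
    EuclideanSpace ℝ (Fin D) := fun y i t => clip C (f.lossGradient θ (subsequence LC LF (y i) t))
  let rest : Dataset N L → SampleMask N L LF lam Lam b → EuclideanSpace ℝ (Fin D) := fun y m =>
    ∑ i, ∑ t, if i = n ∧ t ∈ S then 0 else if m i t = true then G y i t else 0
  let part : Dataset N L → SampleMask N L LF lam Lam b → EuclideanSpace ℝ (Fin D) := fun y a =>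
    ∑ t ∈ S, if a n t = true then G y n t else 0
  have hrest : ∀ m, rest x m = rest x' m := by
    intro m
    refine Finset.sum_congr rfl fun i _ => Finset.sum_congr rfl fun t _ => ?_
    by_cases hi : i = n
    · subst hi
      by_cases ht : t ∈ S
      · simp [ht]
      · simp only [G, hS t ht]
    · have hi' : x i = x' i := hx i fun h => hi (Subtype.ext h)
      simp only [G, hi']
  have hpart : ∀ y a, ‖((σ : ℝ) * C)⁻¹ • part y a‖ ≤
      (S.filter fun t => a n t = true).card / (σ : ℝ) := by
    intro y a
    rw [norm_smul, norm_inv, Real.norm_of_nonneg (mul_pos hσ' hC).le,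
      inv_mul_le_iff₀ (mul_pos hσ' hC)]
    refine (norm_sum_ite_le S (a n) fun t => norm_clip_le hC _).trans (le_of_eq ?_)
    field_simp
  have hexp : ∀ y, ∫⁻ g, φ g ∂stepLaw lam Lam σ C f y b θ =
      ∫⁻ m, ∫⁻ a, ∫⁻ z, φ ((Lam : ℝ)⁻¹ • (rest y m +
        ((σ : ℝ) * C) • (z + ((σ : ℝ) * C)⁻¹ • part y a)))
        ∂stdGaussian (EuclideanSpace ℝ (Fin D)) ∂poissonSampling N L LF lam Lam b
        ∂poissonSampling N L LF lam Lam b := by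
    intro y
    rw [lintegral_stepLaw hφ]
    unfold poissonSampling
    rw [lintegral_pi_pi_resample _ fun i t => i = n ∧ t ∈ S]
    refine lintegral_congr fun m => lintegral_congr fun a => lintegral_congr fun z => ?_
    congr 2
    unfold clippedGradientSum
    rw [sum_sum_resample n S a m fun i t => clip C (f.lossGradient θ (subsequence LC LF (y i) t)),
      smul_add, smul_inv_smul₀ hσC]
    simp only [rest, part, G]
    abel
  have hinner : ∀ m, ∫⁻ a, ∫⁻ z, φ ((Lam : ℝ)⁻¹ • (rest x m +
        ((σ : ℝ) * C) • (z + ((σ : ℝ) * C)⁻¹ • part x a)))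
        ∂stdGaussian (EuclideanSpace ℝ (Fin D)) ∂poissonSampling N L LF lam Lam b ≤
      α * ∫⁻ a, ∫⁻ z, φ ((Lam : ℝ)⁻¹ • (rest x' m +
        ((σ : ℝ) * C) • (z + ((σ : ℝ) * C)⁻¹ • part x' a)))
        ∂stdGaussian (EuclideanSpace ℝ (Fin D)) ∂poissonSampling N L LF lam Lam b + H := by
    intro m
    -- The test is centred at the rest shared by both datasets. Thus `I` depends on `m` but neither
    -- on `a` nor on the dataset, and averaging over `a` below keeps it fixed.
    obtain ⟨I, hI, h⟩ := exists_dominating_test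
      (φ := fun z => φ ((Lam : ℝ)⁻¹ • (rest x' m + ((σ : ℝ) * C) • z)))
      (hφ.comp (by fun_prop)) fun z => hφ1 _
    have hJ : MeasurableSet ((fun y : ℝ => y / σ) ⁻¹' I) := hI.preimage (by fun_prop)
    have hMoG : ∀ s : ℝ, ∫⁻ a : SampleMask N L LF lam Lam b,
        gaussianReal (s * (S.filter fun t => a n t = true).card / σ) 1 I
          ∂poissonSampling N L LF lam Lam b =
        MoG (fun i : Fin (S.card + 1) => s * ((i : ℕ) : ℝ)) p σ ((fun y : ℝ => y / σ) ⁻¹' I) := by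
      intro s
      rw [lintegral_card_poissonSampling n S fun k => gaussianReal (s * (k : ℝ) / σ) 1 I, MoG_apply]
      refine Finset.sum_congr rfl fun k _ => ?_
      rw [hp, gaussianReal_preimage_div hσ _ hI]
    have hneg := hMoG (-1)
    have hpos := hMoG 1
    simp only [neg_mul, one_mul, neg_div] at hneg hpos
    simp only [hrest]
    calc _ ≤ ∫⁻ a : SampleMask N L LF lam Lam b,
        gaussianReal (-((S.filter fun t => a n t = true).card / σ)) 1 I
          ∂poissonSampling N L LF lam Lam b := lintegral_mono fun a => (h _ _ (hpart x a)).1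
      _ ≤ α * ∫⁻ a : SampleMask N L LF lam Lam b,
        gaussianReal ((S.filter fun t => a n t = true).card / σ) 1 I
          ∂poissonSampling N L LF lam Lam b + H := by
        rw [hneg, hpos]
        have hfin : ∀ μ : Fin (S.card + 1) → ℝ, IsProbabilityMeasure (MoG μ p σ) := fun μ =>
          isProbabilityMeasure_MoG (fun k => hp k ▸ measureReal_nonneg) (by
            simp only [hp]; exact sum_binomial_real _ _)
        have := hfin fun i => -((i : ℕ) : ℝ)
        have := hfin fun i => ((i : ℕ) : ℝ)
        exact measure_le_hockeyStick (MoG_absolutelyContinuous hσ) hJ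
      _ ≤ _ := by
        gcongr with a
        exact (h _ _ (hpart x' a)).2
  rw [hexp, hexp]
  calc _ ≤ _ := lintegral_mono hinner
    _ = _ := by
      rw [lintegral_add_right _ measurable_const, lintegral_const_mul _ .of_discrete,
        lintegral_const, measure_univ, mul_one]

lemma stepLaw_congr {b : ℕ} (h : ∀ n ∈ topLevelBatch N lam Lam b, x n = x' n)
    (θ : EuclideanSpace ℝ (Fin D)) :
    stepLaw lam Lam σ C f x b θ = stepLaw lam Lam σ C f x' b θ := by
  have : clippedGradientSum lam Lam C f x b θ = clippedGradientSum lam Lam C f x' b θ := by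
    ext1 m
    unfold clippedGradientSum
    exact Finset.sum_congr rfl fun n _ => by rw [h n n.2]
  unfold stepLaw
  rw [this]

/-- The noisy gradients of a training step on different datasets have the same null sets. -/
lemma stepLaw_absolutelyContinuous (hσ : 0 < σ) (hC : 0 < C) (b : ℕ)
    (θ : EuclideanSpace ℝ (Fin D)) :
    stepLaw lam Lam σ C f x b θ ≪ stepLaw lam Lam σ C f x' b θ := by
  refine Measure.AbsolutelyContinuous.mk fun s hs h => ?_
  have hσC : (σ : ℝ) * C ≠ 0 := by
    have hσ' : (0 : ℝ) < σ := hσ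
    exact (mul_pos hσ' hC).ne'
  rw [← lintegral_indicator_one hs, lintegral_stepLaw (measurable_one.indicator hs),
    lintegral_eq_zero_iff .of_discrete] at h ⊢
  filter_upwards [h] with m hm
  have key : ∀ v : EuclideanSpace ℝ (Fin D),
      ∫⁻ z, s.indicator 1 ((Lam : ℝ)⁻¹ • (v + ((σ : ℝ) * C) • z))
        ∂stdGaussian (EuclideanSpace ℝ (Fin D)) = stdGaussian (EuclideanSpace ℝ (Fin D))
          ((fun z => (Lam : ℝ)⁻¹ • (v + ((σ : ℝ) * C) • z)) ⁻¹' s) := by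
    intro v
    rw [← lintegral_indicator_one (hs.preimage (by fun_prop))]
    rfl
  simp only [key, Pi.zero_apply] at hm ⊢
  -- For a fixed mask, changing the dataset only translates the noise, by the rescaled difference of
  -- the clipped sums.
  have := stdGaussian_shift_null (hs.preimage (by fun_prop)) (((σ : ℝ) * C)⁻¹ •
    (clippedGradientSum lam Lam C f x b θ m - clippedGradientSum lam Lam C f x' b θ m)) hm
  convert this using 2
  ext z
  have hz : clippedGradientSum lam Lam C f x' b θ m + ((σ : ℝ) * C) • (z + ((σ : ℝ) * C)⁻¹ •
      (clippedGradientSum lam Lam C f x b θ m - clippedGradientSum lam Lam C f x' b θ m)) =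
      clippedGradientSum lam Lam C f x b θ m + ((σ : ℝ) * C) • z := by
    rw [smul_add, smul_inv_smul₀ hσC]
    abel
  simp only [Set.mem_preimage, hz]

/-! ### Composition of the training steps -/

lemma measurable_cons {V : Type*} [MeasurableSpace V] {k : ℕ} :
    Measurable fun q : V × (Fin k → V) => (Fin.cons q.1 q.2 : Fin (k + 1) → V) := by
  refine measurable_pi_lambda _ fun i => ?_
  refine Fin.cases ?_ (fun j => ?_) i
  · exact measurable_fst
  · exact (measurable_pi_apply j).comp measurable_snd

lemma isProbabilityMeasure_stepsLaw (k b : ℕ) (θ : EuclideanSpace ℝ (Fin D)) :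
    IsProbabilityMeasure (stepsLaw lam Lam σ C η f x k b θ) :=
  (stepsLaw_aux lam Lam σ C η f x k b).2 θ

lemma measurable_stepsLaw_preimage_cons (k b : ℕ) (θ : EuclideanSpace ℝ (Fin D))
    {s : Set (Fin (k + 1) → EuclideanSpace ℝ (Fin D))} (hs : MeasurableSet s) :
    Measurable fun g => stepsLaw lam Lam σ C η f x k b (θ - η • g)
      ((fun v => (Fin.cons g v : Fin (k + 1) → EuclideanSpace ℝ (Fin D))) ⁻¹' s) := by
  let κ : Kernel (EuclideanSpace ℝ (Fin D)) (Fin k → EuclideanSpace ℝ (Fin D)) :=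
    ⟨fun g => stepsLaw lam Lam σ C η f x k b (θ - η • g),
      (stepsLaw_aux lam Lam σ C η f x k b).1.comp (by fun_prop)⟩
  have : IsMarkovKernel κ := ⟨fun g => isProbabilityMeasure_stepsLaw k b _⟩
  exact Kernel.measurable_kernel_prodMk_left (κ := κ) (measurable_cons hs)

lemma stepsLaw_succ_apply (k b : ℕ) (θ : EuclideanSpace ℝ (Fin D))
    {s : Set (Fin (k + 1) → EuclideanSpace ℝ (Fin D))} (hs : MeasurableSet s) :
    stepsLaw lam Lam σ C η f x (k + 1) b θ s =
      ∫⁻ g, stepsLaw lam Lam σ C η f x k (b + 1) (θ - η • g)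
        ((fun v => (Fin.cons g v : Fin (k + 1) → EuclideanSpace ℝ (Fin D))) ⁻¹' s)
        ∂stepLaw lam Lam σ C f x b θ := by
  have hc : ∀ g, Measurable fun v : Fin k → EuclideanSpace ℝ (Fin D) =>
      (Fin.cons g v : Fin (k + 1) → EuclideanSpace ℝ (Fin D)) :=
    fun g => measurable_cons.comp (measurable_prodMk_left (x := g))
  have hm : Measurable fun g => (stepsLaw lam Lam σ C η f x k (b + 1) (θ - η • g)).map
      fun v => (Fin.cons g v : Fin (k + 1) → EuclideanSpace ℝ (Fin D)) := by
    refine Measure.measurable_of_measurable_coe _ fun s hs => ?_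
    simp_rw [Measure.map_apply (hc _) hs]
    exact measurable_stepsLaw_preimage_cons k (b + 1) θ hs
  rw [stepsLaw, Measure.bind_apply hs hm.aemeasurable]
  exact lintegral_congr fun g => Measure.map_apply (hc g) hs

lemma stepsLaw_congr (k : ℕ) : ∀ b : ℕ,
    (∀ c, b ≤ c → ∀ n ∈ topLevelBatch N lam Lam c, x n = x' n) →
    ∀ θ : EuclideanSpace ℝ (Fin D),
      stepsLaw lam Lam σ C η f x k b θ = stepsLaw lam Lam σ C η f x' k b θ := by
  induction k with
  | zero => exact fun b _ θ => rfl
  | succ k ih =>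
    intro b h θ
    rw [stepsLaw, stepsLaw, stepLaw_congr (h b le_rfl)]
    simp_rw [ih (b + 1) fun c hc => h c (by omega)]

/-- Supplies the hypothesis of `hockeyStick_map_le` in the tightness proof. -/
lemma stepsLaw_absolutelyContinuous (hσ : 0 < σ) (hC : 0 < C) (k : ℕ) :
    ∀ (b : ℕ) (θ : EuclideanSpace ℝ (Fin D)),
      stepsLaw lam Lam σ C η f x k b θ ≪ stepsLaw lam Lam σ C η f x' k b θ := by
  induction k with
  | zero => exact fun b θ => .rfl
  | succ k ih =>
    intro b θ
    refine Measure.AbsolutelyContinuous.mk fun s hs h => ?_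
    rw [stepsLaw_succ_apply k b θ hs,
      lintegral_eq_zero_iff (measurable_stepsLaw_preimage_cons k (b + 1) θ hs)] at h ⊢
    filter_upwards [stepLaw_absolutelyContinuous hσ hC b θ h] with g hg
    exact ih _ _ hg

lemma notMem_topLevelBatch_of_lt {b c : ℕ} {n : Fin N} (hn : n ∈ topLevelBatch N lam Lam b)
    (hbc : b < c) : n ∉ topLevelBatch N lam Lam c := by
  simp only [topLevelBatch, Finset.mem_filter, Finset.mem_univ, true_and, not_and, not_lt] at hn ⊢
  intro h
  have := Nat.mul_le_mul_right (Lam / lam) (Nat.succ_le_of_lt hbc)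
  rw [Nat.succ_eq_add_one] at this
  omega

/-- If each single step on a batch with the `n`-th sequence is dominated, then so is the composition
of all steps, as the `n`-th sequence occurs in at most one batch. -/
lemma stepsLaw_le {α : ℝ≥0} {H : ℝ≥0∞} {n : Fin N} (hx : ∀ m, m ≠ n → x m = x' m)
    (hstep : ∀ b, n ∈ topLevelBatch N lam Lam b → ∀ (θ : EuclideanSpace ℝ (Fin D))
      (φ : EuclideanSpace ℝ (Fin D) → ℝ≥0∞), Measurable φ → (∀ g, φ g ≤ 1) →
      ∫⁻ g, φ g ∂stepLaw lam Lam σ C f x b θ ≤ α * ∫⁻ g, φ g ∂stepLaw lam Lam σ C f x' b θ + H)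
    (h0 : 1 ≤ α + H) (k : ℕ) :
    ∀ (b : ℕ) (θ : EuclideanSpace ℝ (Fin D)) (s : Set (Fin k → EuclideanSpace ℝ (Fin D))),
      MeasurableSet s → stepsLaw lam Lam σ C η f x k b θ s ≤
        α * stepsLaw lam Lam σ C η f x' k b θ s + H := by
  induction k with
  | zero =>
    intro b θ s _
    rw [stepsLaw, stepsLaw]
    rcases Set.eq_empty_or_nonempty s with rfl | ⟨v, hv⟩
    · simp
    · rw [Subsingleton.elim v Fin.elim0] at hv
      simpa [hv] using h0
  | succ k ih =>
    intro b θ s hs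
    rw [stepsLaw_succ_apply k b θ hs, stepsLaw_succ_apply k b θ hs]
    have hm := measurable_stepsLaw_preimage_cons (lam := lam) (Lam := Lam) (σ := σ) (C := C)
      (η := η) (f := f) (x := x') k (b + 1) θ hs
    by_cases hn : n ∈ topLevelBatch N lam Lam b
    -- From here on both datasets agree, so the law of the remaining steps is one `[0, 1]`-valued
    -- function of `g`, a test for the current step.
    · have htail : ∀ c, b + 1 ≤ c → ∀ m ∈ topLevelBatch N lam Lam c, x m = x' m :=
        fun c hc m hmc => hx m fun h => notMem_topLevelBatch_of_lt hn (by omega) (h ▸ hmc)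
      simp_rw [stepsLaw_congr k (b + 1) htail]
      refine hstep b hn θ _ hm fun g => ?_
      have := isProbabilityMeasure_stepsLaw (lam := lam) (Lam := Lam) (σ := σ) (C := C)
        (η := η) (f := f) (x := x') k (b + 1) (θ - η • g)
      exact prob_le_one
    · rw [stepLaw_congr (x := x) (x' := x') fun m hmb => hx m fun h => hn (h ▸ hmb)]
      -- The current step has the same law for both datasets, and this law has mass `1`, so
      -- integrating the inductive bound leaves `H` unchanged.
      refine (lintegral_mono fun g => ih (b + 1) _ _ ?_).trans (le_of_eq ?_)
      · exact (measurable_cons.comp (measurable_prodMk_left (x := g))) hs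
      · rw [lintegral_add_right _ measurable_const, lintegral_const_mul _ hm, lintegral_const,
          measure_univ, mul_one]

/-- The mixtures of Gaussians with binomial weights dominate the mechanism of one epoch. -/
lemma privacyProfile_epochMechanism_le (hL : LC + LF ≤ L + 1 - LF) (hσ : 0 < σ) (hC : 0 < C)
    (p : Fin (LC + LF + 1) → ℝ)
    (hp : ∀ i, p i = (binomial (LC + LF) (samplingRate L LF lam)).real {(i : ℕ)})
    (θ₀ : EuclideanSpace ℝ (Fin D)) (α : ℝ≥0) :
    privacyProfile (EventNeighbor 1)
        (fun x : Dataset N L => epochMechanism lam Lam σ C η f x θ₀) α ≤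
      hockeyStick α (MoG (fun i => -((i : ℕ) : ℝ)) p σ) (MoG (fun i => ((i : ℕ) : ℝ)) p σ) := by
  refine iSup_le fun x => iSup_le fun x' => iSup_le fun hxx => hockeyStick_le ?_
  obtain ⟨n, hx, -, t₀, ht₀⟩ := hxx
  obtain ⟨S, hS, hSt⟩ := exists_card_eq_subsequence_eq hL (a := x n) (a' := x' n) (t₀ := t₀)
    fun s hs => Fin.ext (by have := ht₀ s hs; omega)
  refine stepsLaw_le hx (fun b hn θ φ hφ hφ1 => ?_) ?_ _ 0 θ₀
  · generalize LC + LF = K at p hp hS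
    subst hS
    exact lintegral_stepLaw_le hσ hC ⟨n, hn⟩ hx S hSt θ α hφ hφ1 p hp
  -- The inequality `1 ≤ α + H` is the hockey-stick bound for the two mixtures on the whole line.
  · have hfin : ∀ μ : Fin (LC + LF + 1) → ℝ, IsProbabilityMeasure (MoG μ p σ) := fun μ =>
      isProbabilityMeasure_MoG (fun k => hp k ▸ measureReal_nonneg) (by
        simp only [hp]; exact sum_binomial_real _ _)
    have h1 := hfin fun i => -((i : ℕ) : ℝ)
    have h2 := hfin fun i => ((i : ℕ) : ℝ)
    have := measure_le_hockeyStick (α := α) (MoG_absolutelyContinuous hσ (p := p)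
      (μ := fun i => -((i : ℕ) : ℝ)) (μ' := fun i => ((i : ℕ) : ℝ))) MeasurableSet.univ
    rwa [h1.measure_univ, h2.measure_univ, mul_one] at this

end Training

/-! ### A model and datasets that attain the bound -/

/-- The sign by which a subsequence reacts to a marked event: `-1` if the value `1` occurs in it,
and otherwise `1` if the value `2` occurs in it. -/
def marker {K : ℕ} (w : Fin K → ℝ) : ℝ :=
  open Classical in if ∃ i, w i = 1 then -1 else if ∃ i, w i = 2 then 1 else 0

/-- The model whose loss is linear in the first parameter, with slope `C` times the marker of the
subsequence. -/
def markerModel {D : ℕ} (hD : 1 ≤ D) (LC LF : ℕ) (C : ℝ) : ForecastModel.{u} D LC LF where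
  -- The prediction passes on the context, so the loss can inspect the whole subsequence.
  Pred := ULift.{u} (EuclideanSpace ℝ (Fin D) × (Fin LC → ℝ))
  predict θ c := ⟨(θ, c)⟩
  loss q y := marker (Fin.append q.down.2 y) * C * q.down.1 ⟨0, hD⟩
  differentiable_loss c y :=
    (by fun_prop : Differentiable ℝ fun θ : EuclideanSpace ℝ (Fin D) => θ ⟨0, hD⟩).const_mul
      (marker (Fin.append c y) * C)

/-- The dataset of the constant sequences `3, 4, …` with the value `v` at the index `j` of the first
sequence. -/
def markedDataset (N : ℕ) {L : ℕ} (j : Fin L) {v : ℝ} (hv : v < 3) : Dataset N L where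
  -- The values `n + 3` keep the sequences distinct and avoid both the padding `0` and the marks `1`
  -- and `2`.
  toFun n t := if (n : ℕ) = 0 ∧ t = j then v else (n : ℕ) + 3
  inj' n n' h := by
    have h := congrFun h j
    simp only [and_true] at h
    ext
    have h1 : (0 : ℝ) ≤ (n : ℕ) := Nat.cast_nonneg _
    have h2 : (0 : ℝ) ≤ (n' : ℕ) := Nat.cast_nonneg _
    split_ifs at h with ha hb hb
    · omega
    · linarith
    · linarith
    · exact_mod_cast add_right_cancel h

lemma markedDataset_apply {N L : ℕ} (j : Fin L) {v : ℝ} (hv : v < 3) (n : Fin N) (t : Fin L) :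
    markedDataset N j hv n t = if (n : ℕ) = 0 ∧ t = j then v else (n : ℕ) + 3 := rfl

lemma marker_subsequence_markedDataset {N L LC LF : ℕ} {j : Fin L} (hj : (j : ℕ) + 1 = LF)
    {v s : ℝ} (hv : v < 3) (hvs : v = 1 ∧ s = -1 ∨ v = 2 ∧ s = 1) (n : Fin N)
    (t : Fin (numStarts L LF)) :
    marker (subsequence LC LF (markedDataset N j hv n) t) =
      if (n : ℕ) = 0 ∧ (t : ℕ) < LC + LF then s else 0 := by
  have hn : (0 : ℝ) ≤ (n : ℕ) := Nat.cast_nonneg _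
  have hval : ∀ i, subsequence LC LF (markedDataset N j hv n) t i = 0 ∨
      subsequence LC LF (markedDataset N j hv n) t i = (n : ℕ) + 3 ∨
      (subsequence LC LF (markedDataset N j hv n) t i = v ∧ (n : ℕ) = 0 ∧
        (t : ℕ) < LC + LF) := by
    intro i
    rw [subsequence_apply]
    split_ifs with hi
    · rw [markedDataset_apply]
      split_ifs with h
      · refine Or.inr (Or.inr ⟨rfl, h.1, ?_⟩)
        have := congrArg Fin.val h.2
        simp only at this
        omega
      · exact Or.inr (Or.inl rfl)
    · exact Or.inl rfl
  have hno : ∀ c : ℝ, 0 < c → c < 3 → (c = v → ¬((n : ℕ) = 0 ∧ (t : ℕ) < LC + LF)) →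
      ¬∃ i, subsequence LC LF (markedDataset N j hv n) t i = c := by
    rintro c h0 h3 hc ⟨i, hi⟩
    rcases hval i with h | h | ⟨h, h'⟩
    · linarith
    · linarith
    · exact hc (hi ▸ h) h'
  have hex : (n : ℕ) = 0 ∧ (t : ℕ) < LC + LF →
      ∃ i, subsequence LC LF (markedDataset N j hv n) t i = v := by
    rintro ⟨h0, ht⟩
    -- After padding, the mark sits at position `LC + j = LC + LF - 1`.
    refine ⟨⟨LC + LF - 1 - t, by omega⟩, ?_⟩
    rw [subsequence_apply, dif_pos (by simp only; omega), markedDataset_apply, if_pos]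
    refine ⟨h0, Fin.ext ?_⟩
    simp only
    omega
  unfold marker
  by_cases h : (n : ℕ) = 0 ∧ (t : ℕ) < LC + LF
  · rw [if_pos h]
    rcases hvs with ⟨rfl, rfl⟩ | ⟨rfl, rfl⟩
    · rw [if_pos (hex h)]
    · rw [if_neg (hno 1 one_pos (by norm_num) fun h' => by norm_num at h'), if_pos (hex h)]
  · rw [if_neg h, if_neg (hno 1 one_pos (by norm_num) fun _ => h),
      if_neg (hno 2 two_pos (by norm_num) fun _ => h)]

lemma lossGradient_markerModel {D LC LF : ℕ} (hD : 1 ≤ D) (C : ℝ) (θ : EuclideanSpace ℝ (Fin D))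
    (y : Fin (LC + LF) → ℝ) :
    (markerModel.{u} hD LC LF C).lossGradient θ y =
      (marker y * C) • EuclideanSpace.single (⟨0, hD⟩ : Fin D) (1 : ℝ) := by
  refine HasGradientAt.gradient ?_
  rw [hasGradientAt_iff_hasFDerivAt]
  refine (ContinuousLinearMap.hasFDerivAt _).congr_of_eventuallyEq (.of_forall fun θ' => ?_)
  simp only [markerModel, InnerProductSpace.toDual_apply_apply, inner_smul_left,
    EuclideanSpace.inner_single_left]
  have : Fin.append (fun i : Fin LC => y (Fin.castAdd LF i)) (fun i : Fin LF => y (Fin.natAdd LC i))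
      = y := Fin.append_castAdd_natAdd
  simp [this]

lemma clip_of_norm_le {D : ℕ} {C : ℝ} (hC : 0 < C) {g : EuclideanSpace ℝ (Fin D)} (hg : ‖g‖ ≤ C) :
    clip C g = g := by
  rw [clip, max_eq_left ((div_le_one hC).2 hg), inv_one, one_smul]

lemma stdGaussian_map_eval {D : ℕ} (i : Fin D) :
    (stdGaussian (EuclideanSpace ℝ (Fin D))).map (fun z => z i) = gaussianReal 0 1 := by
  have h := (measurePreserving_eval_multivariateGaussian (μ := (0 : EuclideanSpace ℝ (Fin D)))
    (S := (1 : Matrix (Fin D) (Fin D) ℝ)) Matrix.PosSemidef.one (i := i)).map_eq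
  rw [multivariateGaussian_zero_one] at h
  simpa using h

lemma clippedGradientSum_markedDataset {N L LC LF D lam Lam : ℕ} (hD : 1 ≤ D) {C : ℝ} (hC : 0 < C)
    {j : Fin L} (hj : (j : ℕ) + 1 = LF) {v s : ℝ} (hv : v < 3)
    (hvs : v = 1 ∧ s = -1 ∨ v = 2 ∧ s = 1) {b : ℕ} (n : topLevelBatch N lam Lam b)
    (hn : (n : ℕ) = 0) (θ : EuclideanSpace ℝ (Fin D)) (m : SampleMask N L LF lam Lam b) :
    clippedGradientSum lam Lam C (markerModel.{u} hD LC LF C) (markedDataset N j hv) b θ m =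
      (((Finset.univ.filter fun t : Fin (numStarts L LF) => (t : ℕ) < LC + LF).filter
        fun t => m n t = true).card * (s * C)) •
          EuclideanSpace.single (⟨0, hD⟩ : Fin D) (1 : ℝ) := by
  have hs : |s| = 1 := by rcases hvs with ⟨-, rfl⟩ | ⟨-, rfl⟩ <;> simp
  have hclip : ∀ (i : Fin N) (t : Fin (numStarts L LF)),
      clip C ((markerModel.{u} hD LC LF C).lossGradient θ
        (subsequence LC LF (markedDataset N j hv i) t)) =
      if (i : ℕ) = 0 ∧ (t : ℕ) < LC + LF then
        (s * C) • EuclideanSpace.single (⟨0, hD⟩ : Fin D) (1 : ℝ) else 0 := by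
    intro i t
    rw [lossGradient_markerModel, marker_subsequence_markedDataset hj hv hvs]
    split_ifs
    · refine clip_of_norm_le hC (le_of_eq ?_)
      simp [norm_smul, hs, abs_of_pos hC]
    · simp [clip]
  unfold clippedGradientSum
  simp only [hclip]
  rw [Finset.sum_eq_single n]
  · rw [mul_smul ((Finset.card _ : ℕ) : ℝ), Nat.cast_smul_eq_nsmul, ← Finset.sum_const,
      Finset.sum_filter, Finset.sum_filter]
    refine Finset.sum_congr rfl fun t _ => ?_
    simp only [hn, true_and]
    split_ifs <;> rfl
  · intro i _ hi
    have hi0 : ¬((i : Fin N) : ℕ) = 0 := fun h => hi (Subtype.ext (Fin.ext (h.trans hn.symm)))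
    simp [hi0]
  · simp

/-- After rescaling, the first coordinate of the noisy gradient of the marked dataset is distributed
as a mixture of Gaussians with binomial weights. -/
lemma map_stepLaw_markedDataset {N L LC LF D lam Lam : ℕ} (hL : LC + LF ≤ L + 1 - LF)
    (hD : 1 ≤ D) {σ : ℝ≥0} {C : ℝ} (hC : 0 < C) (hLam : 0 < Lam)
    {j : Fin L} (hj : (j : ℕ) + 1 = LF) {v s : ℝ} (hv : v < 3)
    (hvs : v = 1 ∧ s = -1 ∨ v = 2 ∧ s = 1) {b : ℕ} (n : topLevelBatch N lam Lam b)
    (hn : (n : ℕ) = 0) (θ : EuclideanSpace ℝ (Fin D)) {p : Fin (LC + LF + 1) → ℝ}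
    (hp : ∀ i, p i = (binomial (LC + LF) (samplingRate L LF lam)).real {(i : ℕ)}) :
    (stepLaw lam Lam σ C (markerModel.{u} hD LC LF C) (markedDataset N j hv) b θ).map
      (fun g => Lam / C * g ⟨0, hD⟩) = MoG (fun i => s * ((i : ℕ) : ℝ)) p σ := by
  have hLam' : (Lam : ℝ) ≠ 0 := by exact_mod_cast hLam.ne'
  have hm : Measurable fun g : EuclideanSpace ℝ (Fin D) => (Lam : ℝ) / C * g ⟨0, hD⟩ := by fun_prop
  ext I hI
  have hcard : (Finset.univ.filter fun t : Fin (numStarts L LF) => (t : ℕ) < LC + LF).card =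
      LC + LF := by
    rw [Fin.card_filter_val_lt]
    exact min_eq_right hL
  have hcount := lintegral_card_poissonSampling (lam := lam) n
    (Finset.univ.filter fun t : Fin (numStarts L LF) => (t : ℕ) < LC + LF)
    fun k => gaussianReal (s * k) (σ ^ 2) I
  rw [hcard] at hcount
  simp only [← hp] at hcount
  rw [Measure.map_apply hm hI, MoG_apply, ← hcount, ← lintegral_indicator_one (hm hI),
    lintegral_stepLaw (measurable_one.indicator (hm hI))]
  refine lintegral_congr fun m => ?_
  rw [clippedGradientSum_markedDataset hD hC hj hv hvs n hn]
  set k : ℝ := (((Finset.univ.filter fun t : Fin (numStarts L LF) => (t : ℕ) < LC + LF).filter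
    fun t => m n t = true).card : ℝ)
  have hlaw : gaussianReal (s * k) (σ ^ 2) =
      (stdGaussian (EuclideanSpace ℝ (Fin D))).map fun z => s * k + σ * z ⟨0, hD⟩ := by
    have h1 : gaussianReal (s * k) (σ ^ 2) =
        ((gaussianReal 0 1).map fun ξ => (σ : ℝ) * ξ).map fun ξ => s * k + ξ := by
      rw [gaussianReal_map_const_mul, gaussianReal_map_const_add]
      congr 1
      · ring
      · ext; simp
    rw [h1, ← stdGaussian_map_eval ⟨0, hD⟩, Measure.map_map (by fun_prop) (by fun_prop),
      Measure.map_map (by fun_prop) (by fun_prop)]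
    rfl
  rw [hlaw, Measure.map_apply (by fun_prop) hI, ← lintegral_indicator_one (hI.preimage (by fun_prop))]
  refine lintegral_congr fun z => ?_
  -- The factor `Lam / C` undoes both the averaging and the scale `C` that gradients and noise have
  -- in common.
  have hz : (Lam : ℝ) / C * ((Lam : ℝ)⁻¹ • ((k * (s * C)) •
      EuclideanSpace.single (⟨0, hD⟩ : Fin D) (1 : ℝ) + ((σ : ℝ) * C) • z)) ⟨0, hD⟩ =
      s * k + σ * z ⟨0, hD⟩ := by
    simp
    field_simp
  have hiff : (Lam : ℝ)⁻¹ • ((k * (s * C)) • EuclideanSpace.single (⟨0, hD⟩ : Fin D) (1 : ℝ) +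
      ((σ : ℝ) * C) • z) ∈ (fun g : EuclideanSpace ℝ (Fin D) => (Lam : ℝ) / C * g ⟨0, hD⟩) ⁻¹' I ↔
      z ∈ (fun z : EuclideanSpace ℝ (Fin D) => s * k + σ * z ⟨0, hD⟩) ⁻¹' I := by
    rw [Set.mem_preimage, Set.mem_preimage, hz]
  by_cases h : z ∈ (fun z : EuclideanSpace ℝ (Fin D) => s * k + σ * z ⟨0, hD⟩) ⁻¹' I
  · rw [Set.indicator_of_mem h, Set.indicator_of_mem (hiff.2 h)]
    rfl
  · rw [Set.indicator_of_notMem h, Set.indicator_of_notMem fun h' => h (hiff.1 h')]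

/-- The later steps have total mass `1` given the first gradient, so they integrate out. -/
lemma map_stepsLaw_eval_zero {L LC LF N D : ℕ} {lam Lam : ℕ} {σ : ℝ≥0} {C η : ℝ}
    {f : ForecastModel.{u} D LC LF} {x : Dataset N L} {k : ℕ} (hk : 0 < k) (b : ℕ)
    (θ : EuclideanSpace ℝ (Fin D)) :
    (stepsLaw lam Lam σ C η f x k b θ).map (fun v => v ⟨0, hk⟩) = stepLaw lam Lam σ C f x b θ := by
  obtain ⟨k, rfl⟩ := Nat.exists_eq_succ_of_ne_zero hk.ne'
  ext s hs
  have hm : Measurable fun v : Fin (k + 1) → EuclideanSpace ℝ (Fin D) => v ⟨0, hk⟩ :=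
    measurable_pi_apply _
  rw [Measure.map_apply hm hs, stepsLaw_succ_apply k b θ (hm hs), ← lintegral_indicator_one hs]
  refine lintegral_congr fun g => ?_
  have := isProbabilityMeasure_stepsLaw (lam := lam) (Lam := Lam) (σ := σ) (C := C)
    (η := η) (f := f) (x := x) k (b + 1) (θ - η • g)
  have hpre : (fun v : Fin k → EuclideanSpace ℝ (Fin D) =>
      (Fin.cons g v : Fin (k + 1) → EuclideanSpace ℝ (Fin D))) ⁻¹'
      ((fun v => v ⟨0, hk⟩) ⁻¹' s) = {_v | g ∈ s} := rfl
  rw [hpre]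
  by_cases hg : g ∈ s <;> simp [hg]

/-- The privacy profile of the marker model is at least that of the mixtures of Gaussians. -/
lemma le_privacyProfile_markerModel {L LC LF N D lam Lam : ℕ} (hLF : 1 ≤ LF)
    (hL : LC + LF ≤ L + 1 - LF) (hD : 1 ≤ D) (hlam : 1 ≤ lam) (hLam : lam ≤ Lam)
    (hN : Lam ≤ N * lam) {σ : ℝ≥0} (hσ : 0 < σ) {C : ℝ} (hC : 0 < C) (η : ℝ)
    (θ₀ : EuclideanSpace ℝ (Fin D)) {p : Fin (LC + LF + 1) → ℝ}
    (hp : ∀ i, p i = (binomial (LC + LF) (samplingRate L LF lam)).real {(i : ℕ)}) (α : ℝ≥0) :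
    hockeyStick α (MoG (fun i => -((i : ℕ) : ℝ)) p σ) (MoG (fun i => ((i : ℕ) : ℝ)) p σ) ≤
      privacyProfile (EventNeighbor 1) (fun x : Dataset N L =>
        epochMechanism lam Lam σ C η (markerModel.{u} hD LC LF C) x θ₀) α := by
  have hN0 : 0 < N := Nat.pos_of_ne_zero fun h => by subst h; omega
  -- The earliest event covered by `LC + LF` windows, namely those starting at `0, …, LC + LF - 1`.
  -- They all exist by `hL`.
  let j : Fin L := ⟨LF - 1, by omega⟩
  have hj : (j : ℕ) + 1 = LF := Nat.sub_add_cancel hLF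
  have h1 : (1 : ℝ) < 3 := by norm_num
  have h2 : (2 : ℝ) < 3 := by norm_num
  -- `hN` guarantees at least one step and `hLam` a nonempty first batch, so the marked sequence is
  -- really used.
  have hk : 0 < N * lam / Lam := Nat.div_pos hN (by omega)
  have hn : (⟨0, hN0⟩ : Fin N) ∈ topLevelBatch N lam Lam 0 := by
    simp [topLevelBatch, Nat.div_pos hLam hlam]
  have hmap : ∀ {v s : ℝ} (hv : v < 3), (v = 1 ∧ s = -1 ∨ v = 2 ∧ s = 1) →
      (epochMechanism lam Lam σ C η (markerModel.{u} hD LC LF C) (markedDataset N j hv) θ₀).map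
        (fun w => (Lam : ℝ) / C * w ⟨0, hk⟩ ⟨0, hD⟩) = MoG (fun i => s * ((i : ℕ) : ℝ)) p σ := by
    intro v s hv hvs
    rw [← map_stepLaw_markedDataset (N := N) hL hD hC (by omega : 0 < Lam) hj hv hvs
      ⟨⟨0, hN0⟩, hn⟩ rfl θ₀ hp, ← map_stepsLaw_eval_zero (η := η) hk 0 θ₀,
      Measure.map_map (by fun_prop) (by fun_prop)]
    rfl
  have hneg := hmap h1 (Or.inl ⟨rfl, rfl⟩)
  have hpos := hmap h2 (Or.inr ⟨rfl, rfl⟩)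
  simp only [neg_mul, one_mul] at hneg hpos
  have hnbr : EventNeighbor 1 (markedDataset N j h1) (markedDataset N j h2) := by
    refine ⟨⟨0, hN0⟩, fun m hm => ?_, fun h => ?_, j, fun t ht => ?_⟩
    · have hm0 : ¬(m : ℕ) = 0 := fun h => hm (Fin.ext h)
      ext t
      simp [markedDataset_apply, hm0]
    · have := congrFun h j
      simp [markedDataset_apply] at this
    · by_cases htj : t = j
      · subst htj; omega
      · simp [markedDataset_apply, htj] at ht
  have hac : epochMechanism lam Lam σ C η (markerModel.{u} hD LC LF C) (markedDataset N j h1) θ₀ ≪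
      epochMechanism lam Lam σ C η (markerModel.{u} hD LC LF C) (markedDataset N j h2) θ₀ :=
    stepsLaw_absolutelyContinuous hσ hC _ _ _
  rw [← hneg, ← hpos]
  -- Both mixtures are images of the epoch under one map, so this neighboring pair already reaches
  -- their divergence.
  refine (hockeyStick_map_le hac (by fun_prop)).trans ?_
  unfold privacyProfile
  exact le_iSup_of_le (markedDataset N j h1) (le_iSup_of_le (markedDataset N j h2)
    (le_iSup_of_le hnbr le_rfl))

end

theorem mainTheorem7
    (L LC LF N D lam Lam : ℕ) (σ : ℝ≥0) (C η : ℝ) (θ₀ : EuclideanSpace ℝ (Fin D))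
    (hLF : 1 ≤ LF) (hL : LC + LF ≤ L + 1 - LF) (hD : 1 ≤ D)
    (hlam : 1 ≤ lam) (hLam : lam ≤ Lam) (hN : Lam ≤ N * lam)
    (hσ : 0 < σ) (hC : 0 < C)
    (μ p : Fin (LC + LF + 1) → ℝ)
    (hμ : ∀ i, μ i = ((i : ℕ) : ℝ))
    (hp : ∀ i, p i = (binomial (LC + LF) (samplingRate L LF lam)).real {(i : ℕ)}) :
    (∀ f : ForecastModel.{u} D LC LF,
      IsDominatingPair (EventNeighbor 1)
        (fun x : Dataset N L => epochMechanism lam Lam σ C η f x θ₀)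
        (MoG (fun i => -μ i) p σ) (MoG μ p σ)) ∧
    ∃ f : ForecastModel.{u} D LC LF,
      IsTightDominatingPair (EventNeighbor 1)
        (fun x : Dataset N L => epochMechanism lam Lam σ C η f x θ₀)
        (MoG (fun i => -μ i) p σ) (MoG μ p σ) := by
  obtain rfl : μ = fun i : Fin (LC + LF + 1) => ((i : ℕ) : ℝ) := funext hμ
  have hprob : ∀ ν : Fin (LC + LF + 1) → ℝ, IsProbabilityMeasure (MoG ν p σ) := fun ν =>
    isProbabilityMeasure_MoG (fun k => hp k ▸ measureReal_nonneg) (by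
      simp only [hp]; exact sum_binomial_real _ _)
  exact ⟨fun f => ⟨hprob _, hprob _, privacyProfile_epochMechanism_le hL hσ hC p hp θ₀⟩,
    markerModel hD LC LF C, hprob _, hprob _, fun α => le_antisymm
      (privacyProfile_epochMechanism_le hL hσ hC p hp θ₀ α)
      (le_privacyProfile_markerModel hLF hL hD hlam hLam hN hσ hC η θ₀ hp α)⟩
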